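/- Let $0<\omega_1<\omega_2$ and $\alpha>0$. Put $c_\omega=e^{i\pi/4}\omega^2/\sqrt{8\pi\omega}$, let $\mathbb S\subset\mathbb R^2$ be the unit circle and $\mathcal B$ the unit disc, and let $F=(F^{\omega_1},F^{\omega_2}):L^2(\mathcal B)^2\to L^2(\mathbb S\times\mathbb S)^2$ be the linearized forward operator $$[F^{\omega}(\gamma,\eta)](\hat x,\zeta)=c_\omega\Big(\int_{\mathcal B}-(\hat x\cdot\zeta)e^{i\omega(\zeta-\hat x)\cdot y}\gamma(y)\,dy+\int_{\mathcal B}e^{i\omega(\zeta-\hat x)\cdot y}\eta(y)\,dy\Big).$$ For $j,j'\in\{1,2\}$ let $$g_{jj'}^\omega(y)=(-1)^{j+j'}|c_\omega|^2\int_{\mathbb S\times\mathbb S}(\hat x\cdot\zeta)^{4-j-j'}\cos(\omega(\hat x-\zeta)\cdot y)\,d\hat x\,d\zeta ,$$ and let $\delta$ be the Dirac distribution. Define the matrix kernels $$\mathbf g=\sum_{i=1}^2\begin{bmatrix}g_{11}^{\omega_i}+\frac\alpha2\delta&g_{12}^{\omega_i}\\ g_{21}^{\omega_i}&g_{22}^{\omega_i}+\frac\alpha2\delta\end{bmatrix},\qquad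 g_1=\sum_{i=1}^2\begin{bmatrix}g_{22}^{\omega_i}+\frac\alpha2\delta&-g_{12}^{\omega_i}\\ -g_{21}^{\omega_i}&g_{11}^{\omega_i}+\frac\alpha2\delta\end{bmatrix}.$$ (a) On $L^2(\mathcal B)^2$ the operator $F^*F+\alpha I$ is the convolution with $\mathbf g$. The entrywise Fourier transform $\mathcal F(\mathbf g)$ (of tempered distributions) is a measurable real matrix-valued function, $\det\mathcal F(\mathbf g)\ge\alpha^2$ almost everywhere, and $\mathcal F(g_1)$ is the adjugate of $\mathcal F(\mathbf g)$. Moreover $$g_2:=\mathcal F^{-1}\big(\det(\mathcal F(\mathbf g))^{-1}\big)=\alpha^{-2}\delta-g_{2,\alpha}$$ with a real-valued bounded continuous function $g_{2,\alpha}$. Thus the kernel $\mathcal F^{-1}(\mathcal F(\mathbf g)^{-1})$ of the inverse pseudo-differential operator $(F^*F+\alpha I)^{-1}$ is $(g_2I_2)*g_1$. (b) Let $n_c\ge1$ and $x_{ij}=(\frac{2i-1}{n_c}-1,\frac{2j-1}{n_c}-1)$ for $1\le i,j\le n_c$. For $O_I\in\mathbb R^{2n_c\times n_c}$, viewed as two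 $n_c\times n_c$ blocks, extend both blocks to piecewise constant functions on $[-1,1]^2$, with the value of entry $(i,j)$ on the square cell of side $2/n_c$ centred at $x_{ij}$. Let $\Psi_2\in\mathbb R^{2n_c\times n_c}$ be the array of the values at the points $x_{ij}$ of the two components of $(g_2I_2)*(g_1*O_I)$. Here the input, the intermediate function $g_1*O_I$ and the output are considered on $[-1,1]^2$: for $x\in[-1,1]^2$, convolving $f$ with $a\delta+k$ means $a f(x)+\int_{[-1,1]^2}k(x-y)f(y)\,dy$. Let $P_u=[I\ O]$ and $P_l=[O\ I]$ (of size $n_c\times 2n_c$). For a filter $G\in\mathbb R^{2n_c\times2n_c}$ indexed by offsets in $\{-n_c,\dots,n_c-1\}^2$ put $(G*A)[m,k]=\frac4{n_c^2}\sum_{i,j=1}^{n_c}G[m-i,k-j]A[i,j]$. Then there is a convolutional neural network with scaled residual layers $\psi=\psi_2\circ\psi_1$, $$\psi_1(O_I)=\sum_{i=1}^2\big(P_u^TG_{22}^{\omega_i}*P_u+P_l^TG_{11}^{\omega_i}*P_l-P_u^TG_{12}^{\omega_i}*P_l-P_l^TG_{12}^{\omega_i}*P_u\big)O_I+\alpha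 O_I,$$ $$\psi_2(\tilde O_I)=\alpha^{-2}\tilde O_I-\big(P_u^TG_{2,\alpha}*P_u+P_l^TG_{2,\alpha}*P_l\big)\tilde O_I,$$ whose filters $G_{jj'}^{\omega_i},G_{2,\alpha}\in\mathbb R^{2n_c\times2n_c}$ are the uniform discretizations over $[-2,2]^2$ (step $2/n_c$) of $g_{jj'}^{\omega_i}$ and $g_{2,\alpha}$, such that for every $O_I\in\mathbb R^{2n_c\times n_c}$ $$|\Psi_2-\psi_2\circ\psi_1(O_I)|_\infty\le c_{\mathbf{cnn}}\,|O_I|_\infty\,\alpha^{-2}n_c^{-1},\qquad c_{\mathbf{cnn}}=2^7\sqrt2\,\pi\,\omega_2\big(|c_{\omega_1}|^2+|c_{\omega_2}|^2\big)(\pi+2^3\omega_2^2),$$ where $|\cdot|_\infty$ is the maximum modulus of the entries. -/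

import Mathlib

open MeasureTheory
open scoped SchwartzMap FourierTransform BoundedContinuousFunction ENNReal Matrix ComplexConjugate

noncomputable section

namespace ScatteringCNN

/-- The plane with its Euclidean norm. -/
abbrev Plane : Type := EuclideanSpace ℝ (Fin 2)

/-- The point `(cos θ, sin θ)` of the unit circle. Integrals over the circle are integrals
in `θ` over `[0, 2π]`. -/
def dir (θ : ℝ) : Plane := !₂[Real.cos θ, Real.sin θ]

/-- `c_ω = e^{iπ/4} ω² / √(8πω)`. Wherever the square of `c_ω` enters below it is the squared
modulus. -/
def farFieldConst (ω : ℝ) : ℂ :=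
  Complex.exp (Complex.I * (Real.pi / 4 : ℝ)) * ((ω ^ 2 / Real.sqrt (8 * Real.pi * ω) : ℝ) : ℂ)

/-! ### The linearized forward operator -/

/-- The linearized far-field map at frequency `ω` (with the factor `c_ω`) on the unit disc:
`c_ω (∫ -(x̂·ζ) e^{iω(ζ-x̂)·y} u₁(y) dy + ∫ e^{iω(ζ-x̂)·y} u₂(y) dy)`,
at `x̂ = dir θ`, `ζ = dir φ`. The indices `1, 2` are `0, 1 : Fin 2`. -/
def forward (ω : ℝ) (u : Fin 2 → Plane → ℂ) (θ φ : ℝ) : ℂ :=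
  farFieldConst ω *
    ((∫ y in Metric.ball (0 : Plane) 1, -((inner ℝ (dir θ) (dir φ) : ℝ) : ℂ) *
        Complex.exp (Complex.I * (ω * inner ℝ (dir φ - dir θ) y : ℝ)) * u 0 y) +
      ∫ y in Metric.ball (0 : Plane) 1,
        Complex.exp (Complex.I * (ω * inner ℝ (dir φ - dir θ) y : ℝ)) * u 1 y)

/-- The form `⟨F u, F v⟩ + α ⟨u, v⟩` of the operator `F*F + αI`, where
`F u = (forward ω₁ u, forward ω₂ u)`; the inner products are those of `(L²(𝕊 × 𝕊))²` and of
`(L²)²` of the unit disc. -/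
def normalForm (ω : Fin 2 → ℝ) (α : ℝ) (u v : Fin 2 → Plane → ℂ) : ℂ :=
  (∑ i, ∫ θ in (0 : ℝ)..(2 * Real.pi), ∫ φ in (0 : ℝ)..(2 * Real.pi),
      conj (forward (ω i) u θ φ) * forward (ω i) v θ φ) +
    (α : ℂ) * ∑ j, ∫ y in Metric.ball (0 : Plane) 1, conj (u j y) * v j y

/-! ### Convolution kernels -/

/-- The integrand of the filter `g_{jj'}^ω`. -/
def filterIntegrand (ω : ℝ) (j j' : Fin 2) (y : Plane) (θ φ : ℝ) : ℝ :=
  (inner ℝ (dir θ) (dir φ) : ℝ) ^ (2 - (j : ℕ) - (j' : ℕ)) *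
    Real.cos (ω * inner ℝ (dir θ - dir φ) y)

/-- The filter
`g_{jj'}^ω(y) = (-1)^{j+j'} |c_ω|² ∫∫ (x̂·ζ)^{4-j-j'} cos(ω (x̂-ζ)·y) dx̂ dζ`; since the indices
`1, 2` are `0, 1 : Fin 2`, the exponent reads `2-j-j'`. -/
def filterFun (ω : ℝ) (j j' : Fin 2) (y : Plane) : ℝ :=
  (-1) ^ ((j : ℕ) + (j' : ℕ)) * ‖farFieldConst ω‖ ^ 2 *
    ∫ θ in (0 : ℝ)..(2 * Real.pi), ∫ φ in (0 : ℝ)..(2 * Real.pi), filterIntegrand ω j j' y θ φ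

theorem continuous_dir : Continuous dir := by
  unfold dir
  refine (PiLp.continuous_toLp 2 _).comp (continuous_pi fun i => ?_)
  fin_cases i
  · exact Real.continuous_cos
  · exact Real.continuous_sin

theorem norm_dir (θ : ℝ) : ‖dir θ‖ = 1 := by
  simp [dir, EuclideanSpace.norm_eq]

theorem abs_filterIntegrand_le (ω : ℝ) (j j' : Fin 2) (y : Plane) (θ φ : ℝ) :
    |filterIntegrand ω j j' y θ φ| ≤ 1 := by
  have h1 : |(inner ℝ (dir θ) (dir φ) : ℝ)| ≤ 1 := by
    simpa [norm_dir] using abs_real_inner_le_norm (dir θ) (dir φ)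
  unfold filterIntegrand
  rw [abs_mul, abs_pow]
  exact mul_le_one₀ (pow_le_one₀ (abs_nonneg _) h1) (abs_nonneg _) (Real.abs_cos_le_one _)

theorem continuous_filterFun (ω : ℝ) (j j' : Fin 2) : Continuous (filterFun ω j j') := by
  unfold filterFun
  refine continuous_const.mul ?_
  refine intervalIntegral.continuous_parametric_intervalIntegral_of_continuous' ?_ _ _
  refine intervalIntegral.continuous_parametric_intervalIntegral_of_continuous'
    (f := fun (p : Plane × ℝ) (φ : ℝ) => filterIntegrand ω j j' p.1 p.2 φ) ?_ _ _
  have hd := continuous_dir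
  unfold Function.uncurry filterIntegrand
  fun_prop

theorem norm_filterFun_le (ω : ℝ) (j j' : Fin 2) (y : Plane) :
    ‖filterFun ω j j' y‖ ≤ ‖farFieldConst ω‖ ^ 2 * (2 * Real.pi * (2 * Real.pi)) := by
  have hp : |2 * Real.pi - 0| = 2 * Real.pi := by
    rw [sub_zero, abs_of_pos Real.two_pi_pos]
  have h1 : ∀ θ : ℝ,
      ‖∫ φ in (0 : ℝ)..(2 * Real.pi), filterIntegrand ω j j' y θ φ‖ ≤ 2 * Real.pi := by
    intro θ
    have := intervalIntegral.norm_integral_le_of_norm_le_const (a := 0) (b := 2 * Real.pi)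
      (f := fun φ => filterIntegrand ω j j' y θ φ) (C := 1)
      (fun φ _ => abs_filterIntegrand_le ω j j' y θ φ)
    rwa [one_mul, hp] at this
  have h2 := intervalIntegral.norm_integral_le_of_norm_le_const (a := 0) (b := 2 * Real.pi)
      (f := fun θ => ∫ φ in (0 : ℝ)..(2 * Real.pi), filterIntegrand ω j j' y θ φ)
      (C := 2 * Real.pi) (fun θ _ => h1 θ)
  rw [hp] at h2
  unfold filterFun
  rw [norm_mul, norm_mul, norm_pow, norm_neg, norm_one, one_pow, one_mul, norm_pow, norm_norm]
  exact mul_le_mul_of_nonneg_left h2 (by positivity)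

/-- `g_{jj'}^ω` as a bounded continuous function. -/
def gFilter (ω : ℝ) (j j' : Fin 2) : Plane →ᵇ ℝ :=
  BoundedContinuousFunction.ofNormedAddCommGroup (filterFun ω j j') (continuous_filterFun ω j j')
    _ (norm_filterFun_le ω j j')

/-- A convolution kernel `a δ + k`, with `δ` the Dirac distribution at the origin. -/
structure Kernel where
  atom : ℝ
  density : Plane →ᵇ ℝ

namespace Kernel

/-- The kernel `- (a δ + k)`. -/
def neg (K : Kernel) : Kernel := ⟨-K.atom, -K.density⟩

theorem memLp_density (K : Kernel) :
    MemLp (fun x : Plane => ((K.density x : ℝ) : ℂ)) ∞ volume :=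
  memLp_top_of_bound (Complex.continuous_ofReal.comp K.density.continuous).aestronglyMeasurable
    ‖K.density‖ (Filter.Eventually.of_forall fun x => by
      simpa using K.density.norm_coe_le_norm x)

/-- The tempered distribution `a δ + k`. -/
def toDistribution (K : Kernel) : 𝓢'(Plane, ℂ) :=
  (K.atom : ℂ) • TemperedDistribution.delta (0 : Plane) +
    Lp.toTemperedDistribution (K.memLp_density.toLp _)

/-- The convolution of `a δ + k` with a function `f` on the domain `D` (extended by zero), at a
point of `D`: `a f(x) + ∫_D k(x-y) f(y) dy`. -/
def convOn {V : Type*} [NormedAddCommGroup V] [NormedSpace ℝ V]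
    (K : Kernel) (D : Set Plane) (f : Plane → V) (x : Plane) : V :=
  K.atom • f x + ∫ y in D, K.density (x - y) • f y

end Kernel

/-- The entries of the matrix kernel `𝐠 = ∑ᵢ (g_{jj'}^{ωᵢ} + (α/2) δ_{jj'} δ)` of `F*F + αI`. -/
def gKernel (ω : Fin 2 → ℝ) (α : ℝ) (j j' : Fin 2) : Kernel :=
  ⟨if j = j' then α else 0, ∑ i, gFilter (ω i) j j'⟩

/-- The matrix kernel `g₁`, whose Fourier transform is the adjugate of that of `𝐠`. -/
def g₁Kernel (ω : Fin 2 → ℝ) (α : ℝ) : Matrix (Fin 2) (Fin 2) Kernel :=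
  !![gKernel ω α 1 1, (gKernel ω α 0 1).neg;
     (gKernel ω α 1 0).neg, gKernel ω α 0 0]

/-- The tempered distribution `T` is the function `f`. -/
def Represents (f : Plane → ℝ) (T : 𝓢'(Plane, ℂ)) : Prop :=
  ∀ φ : 𝓢(Plane, ℂ), Integrable (fun x => φ x * (f x : ℂ)) ∧ T φ = ∫ x, φ x * (f x : ℂ)

/-- The measurable matrix-valued function `S` is the entrywise Fourier transform of the matrix
kernel `𝐠` of `F*F + αI`; this determines `S` almost everywhere. -/
def IsSymbol (ω : Fin 2 → ℝ) (α : ℝ) (S : Plane → Matrix (Fin 2) (Fin 2) ℝ) : Prop :=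
  ∀ j j', Measurable (fun ξ => S ξ j j') ∧
    Represents (fun ξ => S ξ j j') (𝓕 (gKernel ω α j j').toDistribution)

/-! ### Grids and the exact operator -/

/-- The square `[-1,1]²`. -/
def square : Set Plane := {x | ∀ k, x k ∈ Set.Icc (-1 : ℝ) 1}

/-- The point `x_{ij} = ((2i-1)/n - 1, (2j-1)/n - 1)` for `i, j = 1, …, n`. -/
def gridPoint {n : ℕ} (i j : Fin n) : Plane :=
  !₂[(2 * (i : ℝ) + 1) / n - 1, (2 * (j : ℝ) + 1) / n - 1]

/-- The cell of side `2/n` with centre `x_{ij}`. -/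
def cell {n : ℕ} (i j : Fin n) : Set Plane :=
  {x | x 0 ∈ Set.Ico (2 * (i : ℝ) / n - 1) (2 * ((i : ℝ) + 1) / n - 1) ∧
       x 1 ∈ Set.Ico (2 * (j : ℝ) / n - 1) (2 * ((j : ℝ) + 1) / n - 1)}

/-- The piecewise constant function on the square with the value `A i j` on the cell `(i, j)`. -/
def pieceConst {n : ℕ} (A : Matrix (Fin n) (Fin n) ℝ) (x : Plane) : ℝ :=
  ∑ i, ∑ j, (cell i j).indicator (fun _ => A i j) x

/-- Arrays in `ℝ^{2n × n}`, as two `n × n` blocks, the first above the second. -/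
abbrev Stacked (n : ℕ) : Type := Matrix (Fin n ⊕ Fin n) (Fin n) ℝ

/-- `P_u = [I O]`. -/
def Pu (n : ℕ) : Matrix (Fin n) (Fin n ⊕ Fin n) ℝ := Matrix.fromCols 1 0

/-- `P_l = [O I]`. -/
def Pl (n : ℕ) : Matrix (Fin n) (Fin n ⊕ Fin n) ℝ := Matrix.fromCols 0 1

/-- The two components of the input, extended to piecewise constant functions. -/
def inputFun {n : ℕ} (O : Stacked n) : Fin 2 → Plane → ℝ :=
  ![pieceConst (Pu n * O), pieceConst (Pl n * O)]

/-- The convolution of a matrix kernel with a vector-valued function on the square. -/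
def matConv (K : Matrix (Fin 2) (Fin 2) Kernel) (f : Fin 2 → Plane → ℝ) (a : Fin 2)
    (x : Plane) : ℝ :=
  ∑ b, (K a b).convOn square (f b) x

/-- The values on the grid of a vector-valued function. -/
def discretize (n : ℕ) (f : Fin 2 → Plane → ℝ) : Stacked n :=
  Matrix.fromRows (Matrix.of fun i j => f 0 (gridPoint i j))
    (Matrix.of fun i j => f 1 (gridPoint i j))

/-- `Ψ₂`: the values on the grid of `(g₂ I₂) * g₁ * O`, where input, intermediate function and
output live on the square. -/
def exactInverse (ω : Fin 2 → ℝ) (α : ℝ) (g₂ : Kernel) {n : ℕ} (O : Stacked n) : Stacked n :=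
  discretize n fun a => g₂.convOn square (matConv (g₁Kernel ω α) (inputFun O) a)

/-! ### The network -/

/-- A convolution filter in `ℝ^{2n × 2n}`; the entry `p` (in `0, …, 2n-1`) of either index
belongs to the offset `p - n`. -/
abbrev ConvFilter (n : ℕ) : Type := Matrix (Fin (2 * n)) (Fin (2 * n)) ℝ

/-- The position in a filter of the offset `m - i`. -/
def offset {n : ℕ} (m i : Fin n) : Fin (2 * n) := ⟨(m : ℕ) + n - i, by omega⟩

/-- The discrete convolution `(G * A)[m, k] = (4/n²) ∑_{i,j} G[m-i, k-j] A[i, j]`. -/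
def discConv {n : ℕ} (G : ConvFilter n) (A : Matrix (Fin n) (Fin n) ℝ) :
    Matrix (Fin n) (Fin n) ℝ :=
  Matrix.of fun m k => 4 / (n : ℝ) ^ 2 * ∑ i, ∑ j, G (offset m i) (offset k j) * A i j

/-- The uniform discretization over `[-2,2]²`, of step `2/n`, of a function. -/
def sample (n : ℕ) (k : Plane → ℝ) : ConvFilter n :=
  Matrix.of fun p q => k !₂[2 * ((p : ℝ) - n) / n, 2 * ((q : ℝ) - n) / n]

/-- The first stage of the network; `G j j' i` is the filter `G_{jj'}^{ωᵢ}`. -/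
def psi₁ {n : ℕ} (α : ℝ) (G : Fin 2 → Fin 2 → Fin 2 → ConvFilter n) (O : Stacked n) :
    Stacked n :=
  (∑ i, ((Pu n)ᵀ * discConv (G 1 1 i) (Pu n * O) + (Pl n)ᵀ * discConv (G 0 0 i) (Pl n * O)
      - (Pu n)ᵀ * discConv (G 0 1 i) (Pl n * O) - (Pl n)ᵀ * discConv (G 0 1 i) (Pu n * O)))
    + α • O

/-- The second stage of the network. -/
def psi₂ {n : ℕ} (α : ℝ) (G₂ : ConvFilter n) (O : Stacked n) : Stacked n :=
  (α ^ 2)⁻¹ • O -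
    ((Pu n)ᵀ * discConv G₂ (Pu n * O) + (Pl n)ᵀ * discConv G₂ (Pl n * O))

/-- The maximum modulus of the entries. -/
def maxEntry {n : ℕ} (A : Stacked n) : ℝ := ⨆ p : (Fin n ⊕ Fin n) × Fin n, |A p.1 p.2|

end ScatteringCNN

end

open ScatteringCNN

/-!
With `ξ = (ω / 2π) (x̂ - ζ)`, the forward operator at frequency `ω` evaluates the Fourier transforms
of its two arguments at `ξ`, and its weight `x̂·ζ = 1 - |x̂ - ζ|² / 2` is a function of `ξ` as well.
Hence everything is governed by the distribution of `x̂ - ζ` for two independent uniform directions.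
This measure is absolutely continuous (`freqMeasure_absolutelyContinuous`): the map
`(θ, φ) ↦ x̂ - ζ` has Jacobian `sin (θ - φ)`, which vanishes only on a null set. No formula for the
density is needed, only that it is nonnegative, even, of known mass, and supported in the disc of
radius `ω / π`. Write `a_i` for this density at the frequency `ω i`, scaled by `‖c_{ω i}‖²`, and
`p_i` for `x̂·ζ` as a function of `ξ`. Each filter is the cosine transform of `a_i` times `1`,
`-p_i` or `p_i²` (`gFilter_eq_cosTransform`), so the Fourier transform of `𝐠` is the function `S =
αI + M` with `M = ∑ a_i (-p_i, 1)ᵀ (-p_i, 1)`, and `F*F + αI` is the convolution with `𝐠` by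
Parseval's identity (`integral_conj_fourierIntegral_mul`, `normalForm_eq`).

By Lagrange's identity, `det S = α² + α T + a_0 a_1 (p_0 - p_1)²` with
`T = tr M = ∑ a_i (1 + p_i²)` (`det_symbol`). So `q = α⁻² - 1 / det S` satisfies `0 ≤ q ≤ α⁻²`,
vanishes outside the disc of radius `ω 1 / π`, and is therefore integrable; its cosine transform is
`g_{2,α}`. Besides, `α q ≤ α⁻² T` (`mul_invSpectrum_le`), which keeps the error bound uniform in
large `α`.

A cosine transform is bounded by the mass of its spectrum, and its Lipschitz constant is at most
`2πR` times this mass if the frequencies are bounded by `R`. The masses are at most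
`4π² ‖c_ω‖²` for the filters and `α⁻² (ω 1)² / π` for `q`, while `α q` has mass at most
`8π² α⁻² ∑ ‖c_{ω i}‖²`. A point of a cell has distance at most `√2 / n` from its centre, so each
discrete convolution is a quadrature rule with an error controlled by these Lipschitz constants
(`abs_integral_sub_discConv_le`). Adding up the errors of both stages
(`maxEntry_exactInverse_sub_le`) gives `128π² + 768π (ω 1)²` in place of the factor
`128π (π + 8(ω 1)²)` of the claim.
-/

namespace ScatteringCNN

/-! ### Cosine transforms -/

/-- The cosine transform `x ↦ ∫ b(ξ) cos(2π ξ·x) dξ` of a real function on the plane. For an even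
integrable `b` it is the (inverse) Fourier transform of `b`. -/
noncomputable def cosTransform (b : Plane → ℝ) (x : Plane) : ℝ :=
  ∫ ξ, b ξ * Real.cos (2 * Real.pi * inner ℝ ξ x)

theorem integrable_mul_cos {b : Plane → ℝ} (hb : Integrable b) (x : Plane) :
    Integrable fun ξ => b ξ * Real.cos (2 * Real.pi * inner ℝ ξ x) := by
  refine hb.mul_bdd (c := 1) ?_ (.of_forall fun ξ => ?_)
  · exact (by fun_prop : Continuous fun ξ : Plane =>
      Real.cos (2 * Real.pi * inner ℝ ξ x)).aestronglyMeasurable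
  · simpa using Real.abs_cos_le_one _

theorem abs_cosTransform_le {b : Plane → ℝ} (hb : Integrable b) (x : Plane) :
    |cosTransform b x| ≤ ∫ ξ, |b ξ| := by
  refine (abs_integral_le_integral_abs).trans
    (integral_mono (integrable_mul_cos hb x).abs hb.abs fun ξ => ?_)
  simp only [abs_mul]
  exact mul_le_of_le_one_right (abs_nonneg _) (Real.abs_cos_le_one _)

theorem continuous_cosTransform {b : Plane → ℝ} (hb : Integrable b) :
    Continuous (cosTransform b) := by
  refine continuous_of_dominated (bound := fun ξ => |b ξ|)
    (fun x => (integrable_mul_cos hb x).aestronglyMeasurable)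
    (fun x => .of_forall fun ξ => ?_) hb.abs (.of_forall fun ξ => by fun_prop)
  rw [Real.norm_eq_abs, abs_mul]
  exact mul_le_of_le_one_right (abs_nonneg _) (Real.abs_cos_le_one _)

theorem abs_cos_sub_cos_le (s t : ℝ) : |Real.cos s - Real.cos t| ≤ |s - t| := by
  have h := Real.lipschitzWith_cos.dist_le_mul s t
  simpa [Real.dist_eq] using h

/-- A function with frequencies in the disc of radius `R` is Lipschitz, with constant `2πR` times
the mass of its spectrum. -/
theorem abs_cosTransform_sub_le {b : Plane → ℝ} (hb : Integrable b) {R : ℝ}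
    (hR : ∀ᵐ ξ, R < ‖ξ‖ → b ξ = 0) (x y : Plane) :
    |cosTransform b x - cosTransform b y| ≤ 2 * Real.pi * R * (∫ ξ, |b ξ|) * ‖x - y‖ := by
  have e : 2 * Real.pi * R * (∫ ξ, |b ξ|) * ‖x - y‖ =
      ∫ ξ, 2 * Real.pi * R * ‖x - y‖ * |b ξ| := by
    rw [integral_const_mul]; ring
  unfold cosTransform
  rw [e, ← integral_sub (integrable_mul_cos hb x) (integrable_mul_cos hb y)]
  refine abs_integral_le_integral_abs.trans (integral_mono_ae
    ((integrable_mul_cos hb x).sub (integrable_mul_cos hb y)).abs (hb.abs.const_mul _) ?_)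
  filter_upwards [hR] with ξ hξ
  by_cases h : R < ‖ξ‖
  · simp [hξ h]
  rw [← mul_sub, abs_mul, mul_comm]
  refine mul_le_mul_of_nonneg_right ((abs_cos_sub_cos_le _ _).trans ?_) (abs_nonneg _)
  rw [← mul_sub, ← inner_sub_right, abs_mul, abs_of_pos Real.two_pi_pos]
  calc 2 * Real.pi * |inner ℝ ξ (x - y)| ≤ 2 * Real.pi * (‖ξ‖ * ‖x - y‖) := by
        gcongr; exact abs_real_inner_le_norm _ _
    _ ≤ 2 * Real.pi * (R * ‖x - y‖) := by gcongr; exact not_lt.1 h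
    _ = _ := by ring

theorem integral_mul_sin_eq_zero {b : Plane → ℝ} (hev : ∀ᵐ ξ, b (-ξ) = b ξ) (x : Plane) :
    ∫ ξ, b ξ * Real.sin (2 * Real.pi * inner ℝ ξ x) = 0 := by
  have h := integral_neg_eq_self (fun ξ => b ξ * Real.sin (2 * Real.pi * inner ℝ ξ x)) volume
  have h2 : (∫ ξ, b (-ξ) * Real.sin (2 * Real.pi * inner ℝ (-ξ) x)) =
      ∫ ξ, -(b ξ * Real.sin (2 * Real.pi * inner ℝ ξ x)) := by
    refine integral_congr_ae ?_
    filter_upwards [hev] with ξ hξ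
    simp [hξ, Real.sin_neg]
  rw [h2, integral_neg] at h
  linarith

theorem integrable_ofReal_mul_exp {b : Plane → ℝ} (hb : Integrable b) (x : Plane) :
    Integrable fun ξ : Plane =>
      (b ξ : ℂ) * Complex.exp (((2 * Real.pi * inner ℝ ξ x : ℝ) : ℂ) * Complex.I) := by
  refine hb.ofReal.mul_bdd (c := 1) ?_ (.of_forall fun ξ => ?_)
  · exact (by fun_prop : Continuous fun ξ : Plane =>
      Complex.exp (((2 * Real.pi * inner ℝ ξ x : ℝ) : ℂ) * Complex.I)).aestronglyMeasurable
  · rw [Complex.norm_exp_ofReal_mul_I]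

theorem integral_ofReal_mul_exp {b : Plane → ℝ} (hb : Integrable b)
    (hev : ∀ᵐ ξ, b (-ξ) = b ξ) (x : Plane) :
    ∫ ξ, (b ξ : ℂ) * Complex.exp (((2 * Real.pi * inner ℝ ξ x : ℝ) : ℂ) * Complex.I) =
      cosTransform b x := by
  have hre : ∀ ξ : Plane, ((b ξ : ℂ) *
      Complex.exp (((2 * Real.pi * inner ℝ ξ x : ℝ) : ℂ) * Complex.I)).re =
      b ξ * Real.cos (2 * Real.pi * inner ℝ ξ x) := fun ξ => by
    rw [Complex.re_ofReal_mul, Complex.exp_ofReal_mul_I_re]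
  have him : ∀ ξ : Plane, ((b ξ : ℂ) *
      Complex.exp (((2 * Real.pi * inner ℝ ξ x : ℝ) : ℂ) * Complex.I)).im =
      b ξ * Real.sin (2 * Real.pi * inner ℝ ξ x) := fun ξ => by
    rw [Complex.im_ofReal_mul, Complex.exp_ofReal_mul_I_im]
  have hi := integrable_ofReal_mul_exp hb x
  refine Complex.ext ?_ ?_
  · rw [← RCLike.re_eq_complex_re, ← integral_re hi]
    simp only [RCLike.re_eq_complex_re, hre, Complex.ofReal_re]
    rfl
  · rw [← RCLike.im_eq_complex_im, ← integral_im hi]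
    simp only [RCLike.im_eq_complex_im, him, Complex.ofReal_im]
    exact integral_mul_sin_eq_zero hev x

/-- A kernel `a δ + k`, with `k` the cosine transform of an even integrable `b`, has the Fourier
transform `a + b`. -/
theorem represents_fourier_toDistribution (K : Kernel) {b : Plane → ℝ} (hb : Integrable b)
    (hev : ∀ᵐ ξ, b (-ξ) = b ξ) (hK : ∀ x, K.density x = cosTransform b x) :
    Represents (fun ξ => K.atom + b ξ) (𝓕 K.toDistribution) := by
  intro φ
  have hb' : Integrable fun ξ => φ ξ * (b ξ : ℂ) := by
    obtain ⟨C, hC⟩ : ∃ C, ∀ x, ‖φ x‖ ≤ C := ⟨_, φ.toBoundedContinuousFunction.norm_coe_le_norm⟩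
    exact hb.ofReal.bdd_mul φ.continuous.aestronglyMeasurable (.of_forall hC)
  have ha : Integrable fun ξ => φ ξ * (K.atom : ℂ) := φ.integrable.mul_const _
  have hsplit : ∀ ξ, φ ξ * ((K.atom + b ξ : ℝ) : ℂ) = φ ξ * (K.atom : ℂ) + φ ξ * (b ξ : ℂ) :=
    fun ξ => by push_cast; ring
  have h0 : 𝓕 φ 0 = ∫ ξ, φ ξ := by
    rw [SchwartzMap.fourier_coe, Real.fourier_eq]
    simp
  have h1 : ∫ x, 𝓕 φ x * (K.density x : ℂ) = ∫ ξ, φ ξ * (b ξ : ℂ) := by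
    have hself := VectorFourier.integral_fourierIntegral_smul_eq_flip (L := -innerₗ Plane)
      (μ := volume) (ν := volume) Real.continuous_fourierChar
      (by simpa using (continuous_inner (𝕜 := ℝ) (E := Plane)).fun_neg) (𝓕 φ).integrable
      hb.ofReal (F := ℂ)
    have hl : ∀ ξ, VectorFourier.fourierIntegral Real.fourierChar volume (-innerₗ Plane)
        (𝓕 φ : 𝓢(Plane, ℂ)) ξ = φ ξ := fun ξ => by
      have : (𝓕⁻ (𝓕 φ : 𝓢(Plane, ℂ)) : 𝓢(Plane, ℂ)) ξ = φ ξ := by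
        rw [FourierTransform.fourierInv_fourier_eq]
      rw [← this, SchwartzMap.fourierInv_coe]
      rfl
    have hr : ∀ x, VectorFourier.fourierIntegral Real.fourierChar volume (-innerₗ Plane).flip
        (fun ξ => (b ξ : ℂ)) x = (K.density x : ℂ) := fun x => by
      rw [hK, ← integral_ofReal_mul_exp hb hev, VectorFourier.fourierIntegral]
      refine integral_congr_ae (.of_forall fun ξ => ?_)
      simp [Circle.smul_def, Real.fourierChar_apply, real_inner_comm, mul_comm]
    simp only [hl] at hself
    simp only [smul_eq_mul] at hself
    refine Eq.trans (integral_congr_ae (.of_forall fun x => ?_)) hself.symm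
    exact congrArg _ (hr x).symm
  refine ⟨by simpa only [hsplit] using ha.fun_add hb', ?_⟩
  simp only [hsplit]
  rw [integral_add ha hb', TemperedDistribution.fourier_apply, integral_mul_const, ← h0, ← h1,
    Kernel.toDistribution]
  change (K.atom : ℂ) • (TemperedDistribution.delta (0 : Plane) (𝓕 φ)) +
    Lp.toTemperedDistribution (K.memLp_density.toLp _) (𝓕 φ) = _
  rw [Lp.toTemperedDistribution_apply, TemperedDistribution.delta_apply, smul_eq_mul, mul_comm]
  congr 1
  refine integral_congr_ae ?_
  filter_upwards [K.memLp_density.coeFn_toLp] with x hx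
  rw [hx, smul_eq_mul]

/-- Parseval's identity for a convolution: multiplication by `b` on the Fourier side is convolution
with the cosine transform of `b`. The Fourier transforms are those of the measures `u μ`, `v μ`. -/
theorem integral_conj_fourierIntegral_mul {b : Plane → ℝ} (hb : Integrable b)
    (hev : ∀ᵐ ξ, b (-ξ) = b ξ) (μ : Measure Plane) [SigmaFinite μ] {u v : Plane → ℂ}
    (hu : Integrable u μ) (hv : Integrable v μ) :
    ∫ ξ, conj (VectorFourier.fourierIntegral Real.fourierChar μ (innerₗ Plane) u ξ) *
        ((b ξ : ℂ) * VectorFourier.fourierIntegral Real.fourierChar μ (innerₗ Plane) v ξ) =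
      ∫ y, conj (u y) * ∫ y', (cosTransform b (y - y') : ℂ) * v y' ∂μ ∂μ := by
  have hL : Continuous fun p : Plane × Plane => innerₗ Plane p.1 p.2 := by
    simpa using continuous_inner
  have hbv : Integrable fun ξ => (b ξ : ℂ) *
      VectorFourier.fourierIntegral Real.fourierChar μ (innerₗ Plane) v ξ := by
    refine hb.ofReal.mul_bdd (c := ∫ x, ‖v x‖ ∂μ)
      (VectorFourier.fourierIntegral_continuous Real.continuous_fourierChar hL
        hv).aestronglyMeasurable (.of_forall fun ξ => ?_)
    exact VectorFourier.norm_fourierIntegral_le_integral_norm _ _ _ _ _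
  have h1 := VectorFourier.integral_sesq_fourierIntegral_eq_neg_flip (L := innerₗ Plane)
    (μ := μ) (ν := volume) (innerSL ℂ) Real.continuous_fourierChar hL hu hbv
  simp only [innerSL_apply_apply, RCLike.inner_apply'] at h1
  refine h1.trans (integral_congr_ae (.of_forall fun y => ?_))
  simp only
  congr 1
  -- the exponential `e^{2πi ξ·y}` is absorbed into the spectrum of the kernel
  set e : Plane → ℂ := fun ξ =>
    Complex.exp (((2 * Real.pi * inner ℝ ξ y : ℝ) : ℂ) * Complex.I)
  have h2 := VectorFourier.integral_fourierIntegral_smul_eq_flip (L := innerₗ Plane)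
    (μ := μ) (ν := volume) Real.continuous_fourierChar hL hv (integrable_ofReal_mul_exp hb y)
  have h3 : ∀ y', VectorFourier.fourierIntegral Real.fourierChar volume (innerₗ Plane).flip
      (fun ξ => (b ξ : ℂ) * e ξ) y' = cosTransform b (y - y') := fun y' => by
    rw [← integral_ofReal_mul_exp hb hev, VectorFourier.fourierIntegral]
    refine integral_congr_ae (.of_forall fun ξ => ?_)
    simp only [Circle.smul_def, Real.fourierChar_apply, LinearMap.flip_apply, innerₗ_apply_apply,
      smul_eq_mul, e, inner_sub_right]
    rw [mul_left_comm, ← Complex.exp_add, real_inner_comm ξ y']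
    congr 2
    push_cast
    ring
  simp only [e, h3, smul_eq_mul, mul_comm (v _)] at h2
  rw [← h2, VectorFourier.fourierIntegral]
  refine integral_congr_ae (.of_forall fun ξ => ?_)
  simp only [Circle.smul_def, Real.fourierChar_apply, LinearMap.flip_apply, innerₗ_apply_apply,
    smul_eq_mul, LinearMap.neg_apply, neg_neg, real_inner_comm ξ y]
  ring

/-! ### Absolute continuity of push-forwards -/

/-- A strictly differentiable map with almost everywhere invertible derivative pulls null sets back
to null sets: near a point with invertible derivative it is injective, and the change of variables
formula applies. -/
theorem quasiMeasurePreserving_of_det_ne_zero {E : Type*} [NormedAddCommGroup E] [NormedSpace ℝ E]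
    [FiniteDimensional ℝ E] [MeasurableSpace E] [BorelSpace E] (μ : Measure E)
    [μ.IsAddHaarMeasure] {f : E → E} {f' : E → E →L[ℝ] E}
    (hf : ∀ x, HasStrictFDerivAt f (f' x) x) (hdet : ∀ᵐ x ∂μ, (f' x).det ≠ 0) :
    Measure.QuasiMeasurePreserving f μ μ := by
  have : CompleteSpace E := FiniteDimensional.complete ℝ E
  have hc : Continuous f := continuous_iff_continuousAt.2 fun x => (hf x).continuousAt
  refine ⟨hc.measurable, Measure.AbsolutelyContinuous.mk fun N hN hN0 => ?_⟩
  rw [Measure.map_apply hc.measurable hN]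
  have hdet' : μ {x | ¬ (f' x).det ≠ 0} = 0 := hdet
  have hloc : μ (f ⁻¹' N ∩ {x | (f' x).det ≠ 0}) = 0 := by
    refine measure_null_of_locally_null _ fun x hx => ?_
    have hfx : HasStrictFDerivAt f
        (((f' x).toContinuousLinearEquivOfDetNeZero hx.2 : E ≃L[ℝ] E) : E →L[ℝ] E) x := by
      simpa using hf x
    set e := hfx.toOpenPartialHomeomorph f with he
    have hxe : x ∈ e.source := hfx.mem_toOpenPartialHomeomorph_source
    refine ⟨f ⁻¹' N ∩ {x | (f' x).det ≠ 0} ∩ e.source, ?_, ?_⟩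
    · exact Filter.inter_mem self_mem_nhdsWithin
        (mem_nhdsWithin_of_mem_nhds (e.open_source.mem_nhds hxe))
    have hinj : Set.InjOn f e.source := by
      have := e.injOn
      rwa [he, hfx.toOpenPartialHomeomorph_coe, ← he] at this
    have hs : MeasurableSet (f ⁻¹' N ∩ e.source) :=
      (hc.measurable hN).inter e.open_source.measurableSet
    have hA := lintegral_abs_det_fderiv_eq_addHaar_image μ hs
      (fun y _ => (hf y).hasFDerivAt.hasFDerivWithinAt) (hinj.mono Set.inter_subset_right)
    have h0 : μ (f '' (f ⁻¹' N ∩ e.source)) = 0 :=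
      measure_mono_null (by rintro _ ⟨y, hy, rfl⟩; exact hy.1) hN0
    rw [h0] at hA
    have hm : AEMeasurable (fun y => ENNReal.ofReal |(f' y).det|)
        (μ.restrict (f ⁻¹' N ∩ e.source)) :=
      aemeasurable_ofReal_abs_det_fderivWithin μ hs
        (fun y _ => (hf y).hasFDerivAt.hasFDerivWithinAt)
    rw [lintegral_eq_zero_iff' hm, Filter.EventuallyEq, ae_restrict_iff' hs] at hA
    refine measure_mono_null (fun y hy => ?_) hA
    simp only [Set.mem_compl_iff, Set.mem_ofPred_eq, Pi.zero_apply, ENNReal.ofReal_eq_zero]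
    intro h
    exact absurd (h ⟨hy.1.1, hy.2⟩) (not_le.2 (abs_pos.2 hy.1.2))
  refine measure_mono_null (fun x hx => ?_) (measure_union_null hloc hdet')
  by_cases h : (f' x).det ≠ 0
  · exact Or.inl ⟨hx, h⟩
  · exact Or.inr h

/-! ### The spectral measure of the difference of two directions -/

/-- The frequency `(ω / 2π) (x̂ - ζ)` at `x̂ = dir p.1`, `ζ = dir p.2`. -/
noncomputable def freq (ω : ℝ) (p : ℝ × ℝ) : Plane := (ω / (2 * Real.pi)) • (dir p.1 - dir p.2)

/-- Lebesgue measure on the interval of angles. -/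
noncomputable abbrev angleMeasure : Measure ℝ := volume.restrict (Set.Ioc 0 (2 * Real.pi))

/-- The distribution of the frequency `(ω / 2π) (x̂ - ζ)` for `x̂`, `ζ` on the circle. -/
noncomputable def freqMeasure (ω : ℝ) : Measure Plane :=
  (angleMeasure.prod angleMeasure).map (freq ω)

theorem continuous_freq (ω : ℝ) : Continuous (freq ω) := by
  have := continuous_dir
  unfold freq
  fun_prop

instance (ω : ℝ) : IsFiniteMeasure (freqMeasure ω) := by
  unfold freqMeasure; infer_instance

theorem norm_freq_le {ω : ℝ} (hω : 0 < ω) (p : ℝ × ℝ) : ‖freq ω p‖ ≤ ω / Real.pi := by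
  have h := norm_sub_le (dir p.1) (dir p.2)
  rw [norm_dir, norm_dir] at h
  have hπ := Real.pi_pos
  rw [freq, norm_smul, Real.norm_of_nonneg (by positivity)]
  calc ω / (2 * Real.pi) * ‖dir p.1 - dir p.2‖ ≤ ω / (2 * Real.pi) * (1 + 1) := by gcongr
    _ = ω / Real.pi := by field_simp; norm_num

theorem freqMeasure_norm_gt {ω : ℝ} (hω : 0 < ω) :
    freqMeasure ω {ξ | ω / Real.pi < ‖ξ‖} = 0 := by
  rw [freqMeasure, Measure.map_apply (continuous_freq ω).measurable
    (measurableSet_lt measurable_const measurable_norm)]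
  convert measure_empty (μ := angleMeasure.prod angleMeasure)
  ext p
  simpa using norm_freq_le hω p

theorem map_neg_freqMeasure (ω : ℝ) : (freqMeasure ω).map (fun ξ => -ξ) = freqMeasure ω := by
  have hm := (continuous_freq ω).measurable
  rw [freqMeasure, Measure.map_map measurable_neg hm]
  conv_rhs => rw [← Measure.prod_swap, Measure.map_map hm measurable_swap]
  congr 1
  ext1 p
  simp only [Function.comp, freq, Prod.fst_swap, Prod.snd_swap, ← smul_neg, neg_sub]

/-- Integration against `freqMeasure` is iterated integration over the angles. -/
theorem integral_freqMeasure {E : Type*} [NormedAddCommGroup E] [NormedSpace ℝ E] (ω : ℝ)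
    {h : Plane → E} (hh : Continuous h) :
    ∫ ξ, h ξ ∂freqMeasure ω =
      ∫ θ in (0 : ℝ)..(2 * Real.pi), ∫ φ in (0 : ℝ)..(2 * Real.pi), h (freq ω (θ, φ)) := by
  have hc : Continuous fun p => h (freq ω p) := hh.comp (continuous_freq ω)
  simp only [intervalIntegral.integral_of_le Real.two_pi_pos.le]
  rw [freqMeasure, integral_map_of_stronglyMeasurable (continuous_freq ω).measurable,
    integral_prod]
  · rw [Measure.prod_restrict]
    exact (hc.continuousOn.integrableOn_compact (isCompact_Icc.prod isCompact_Icc)).mono_set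
      (Set.prod_mono Set.Ioc_subset_Icc_self Set.Ioc_subset_Icc_self)
  · exact hh.stronglyMeasurable

/-- The derivative of `(θ, φ) ↦ c (cos θ - cos φ, sin θ - sin φ)`. -/
noncomputable def fderivFreq (c : ℝ) (p : ℝ × ℝ) : ℝ × ℝ →L[ℝ] ℝ × ℝ :=
  (Matrix.toLin (.finTwoProd ℝ) (.finTwoProd ℝ)
    !![-(c * Real.sin p.1), c * Real.sin p.2;
       c * Real.cos p.1, -(c * Real.cos p.2)]).toContinuousLinearMap

theorem hasStrictFDerivAt_freq (c : ℝ) (p : ℝ × ℝ) :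
    HasStrictFDerivAt (fun p : ℝ × ℝ => (c * (Real.cos p.1 - Real.cos p.2),
      c * (Real.sin p.1 - Real.sin p.2))) (fderivFreq c p) p := by
  unfold fderivFreq
  rw [Matrix.toLin_finTwoProd_toContinuousLinearMap]
  convert! HasStrictFDerivAt.prodMk (𝕜 := ℝ)
    ((((Real.hasStrictDerivAt_cos p.1).comp_hasStrictFDerivAt p hasStrictFDerivAt_fst).sub
      ((Real.hasStrictDerivAt_cos p.2).comp_hasStrictFDerivAt p hasStrictFDerivAt_snd)).const_mul c)
    ((((Real.hasStrictDerivAt_sin p.1).comp_hasStrictFDerivAt p hasStrictFDerivAt_fst).sub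
      ((Real.hasStrictDerivAt_sin p.2).comp_hasStrictFDerivAt p hasStrictFDerivAt_snd)).const_mul c)
    using 2 <;>
  · ext <;> simp

theorem det_fderivFreq (c : ℝ) (p : ℝ × ℝ) :
    (fderivFreq c p).det = c ^ 2 * Real.sin (p.1 - p.2) := by
  unfold fderivFreq
  simp only [LinearMap.det_toContinuousLinearMap, LinearMap.det_toLin, Matrix.det_fin_two_of]
  rw [Real.sin_sub]
  ring

theorem ae_sin_sub_ne_zero : ∀ᵐ p : ℝ × ℝ, Real.sin (p.1 - p.2) ≠ 0 := by
  rw [Measure.volume_eq_prod, Measure.ae_prod_iff_ae_ae]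
  · refine .of_forall fun θ => ?_
    refine Set.Countable.ae_notMem (s := {φ | Real.sin (θ - φ) = 0}) ?_ volume
    refine (Set.countable_range fun n : ℤ => θ - n * Real.pi).mono fun φ hφ => ?_
    obtain ⟨n, hn⟩ := Real.sin_eq_zero_iff.1 hφ
    exact ⟨n, by simp only [hn]; ring⟩
  · exact (isOpen_ne_fun (by fun_prop) continuous_const).measurableSet

/-- The difference of two independent uniform directions has a density: the map to the plane has
Jacobian `sin (θ - φ)` up to a factor. -/
theorem freqMeasure_absolutelyContinuous {ω : ℝ} (hω : 0 < ω) : freqMeasure ω ≪ volume := by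
  set c := ω / (2 * Real.pi)
  have hc : c ≠ 0 := by have := Real.pi_pos; positivity
  have h1 := quasiMeasurePreserving_of_det_ne_zero (volume : Measure (ℝ × ℝ))
    (hasStrictFDerivAt_freq c) (by
      filter_upwards [ae_sin_sub_ne_zero] with p hp
      rw [det_fderivFreq]
      exact mul_ne_zero (pow_ne_zero 2 hc) hp)
  have h2 := ((EuclideanSpace.volume_preserving_symm_measurableEquiv_toLp (Fin 2)).symm
    (MeasurableEquiv.toLp 2 (Fin 2 → ℝ)).symm).quasiMeasurePreserving
  have h3 := ((volume_preserving_finTwoArrow ℝ).symm MeasurableEquiv.finTwoArrow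
    ).quasiMeasurePreserving
  have h4 := (h2.comp (h3.comp h1)).absolutelyContinuous
  have hcomp : (⇑(MeasurableEquiv.toLp 2 (Fin 2 → ℝ)).symm.symm ∘
      ⇑(MeasurableEquiv.finTwoArrow (α := ℝ)).symm ∘ fun p : ℝ × ℝ =>
        (c * (Real.cos p.1 - Real.cos p.2), c * (Real.sin p.1 - Real.sin p.2))) = freq ω := by
    ext p i
    fin_cases i <;> simp [freq, dir, c, MeasurableEquiv.finTwoArrow]
  rw [hcomp] at h4
  refine Measure.AbsolutelyContinuous.trans ?_ h4
  refine Measure.AbsolutelyContinuous.map ?_ (continuous_freq ω).measurable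
  rw [Measure.prod_restrict, ← Measure.volume_eq_prod]
  exact Measure.restrict_le_self.absolutelyContinuous

/-! ### Spectral densities of the filters -/

/-- The density of `‖c_ω‖²` times the frequency measure: the Fourier transform of the filter
`g_{22}^ω`. -/
noncomputable def specDensity (ω : ℝ) (ξ : Plane) : ℝ :=
  ‖farFieldConst ω‖ ^ 2 * ((freqMeasure ω).rnDeriv volume ξ).toReal

/-- The value of `x̂·ζ` at directions with `(ω / 2π) (x̂ - ζ) = ξ`. -/
noncomputable def cosAngle (ω : ℝ) (ξ : Plane) : ℝ := 1 - (2 * Real.pi / ω) ^ 2 * ‖ξ‖ ^ 2 / 2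

/-- The Fourier transform of the filter `g_{jj'}^ω`. -/
noncomputable def filterSpectrum (ω : ℝ) (j j' : Fin 2) (ξ : Plane) : ℝ :=
  (-cosAngle ω ξ) ^ (1 - (j : ℕ)) * (-cosAngle ω ξ) ^ (1 - (j' : ℕ)) * specDensity ω ξ

theorem measurable_specDensity (ω : ℝ) : Measurable (specDensity ω) :=
  (Measure.measurable_rnDeriv _ _).ennreal_toReal.const_mul _

theorem specDensity_nonneg (ω : ℝ) (ξ : Plane) : 0 ≤ specDensity ω ξ := by
  unfold specDensity; positivity

theorem continuous_cosAngle (ω : ℝ) : Continuous (cosAngle ω) := by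
  unfold cosAngle; fun_prop

theorem measurable_filterSpectrum (ω : ℝ) (j j' : Fin 2) : Measurable (filterSpectrum ω j j') := by
  have h1 := (continuous_cosAngle ω).measurable
  have h2 := measurable_specDensity ω
  unfold filterSpectrum
  fun_prop

theorem integrable_specDensity (ω : ℝ) : Integrable (specDensity ω) :=
  Measure.integrable_toReal_rnDeriv.const_mul _

/-- Integrals against the spectral density are integrals over pairs of directions. -/
theorem integral_specDensity_smul {E : Type*} [NormedAddCommGroup E] [NormedSpace ℝ E] {ω : ℝ}
    (hω : 0 < ω) {h : Plane → E} (hh : Continuous h) :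
    ∫ ξ, specDensity ω ξ • h ξ = ‖farFieldConst ω‖ ^ 2 •
      ∫ θ in (0 : ℝ)..(2 * Real.pi), ∫ φ in (0 : ℝ)..(2 * Real.pi), h (freq ω (θ, φ)) := by
  simp only [specDensity, mul_smul]
  rw [integral_smul, integral_rnDeriv_smul (freqMeasure_absolutelyContinuous hω),
    integral_freqMeasure ω hh]

theorem integral_specDensity {ω : ℝ} (hω : 0 < ω) :
    ∫ ξ, specDensity ω ξ = ‖farFieldConst ω‖ ^ 2 * (4 * Real.pi ^ 2) := by
  have h := integral_specDensity_smul hω (continuous_const (y := (1 : ℝ)))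
  simp only [smul_eq_mul, mul_one, intervalIntegral.integral_const] at h
  rw [h]
  ring

theorem specDensity_neg (ω : ℝ) : ∀ᵐ ξ, specDensity ω (-ξ) = specDensity ω ξ := by
  have h := (Homeomorph.neg Plane).measurableEmbedding.rnDeriv_map (freqMeasure ω) volume
  have h1 : (freqMeasure ω).map (Homeomorph.neg Plane) = freqMeasure ω := map_neg_freqMeasure ω
  have h2 : (volume : Measure Plane).map (Homeomorph.neg Plane) = volume :=
    Measure.map_neg_eq_self volume
  rw [h1, h2] at h
  filter_upwards [h] with ξ hξ
  have : (Homeomorph.neg Plane) ξ = -ξ := rfl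
  rw [this] at hξ
  rw [specDensity, specDensity, hξ]

theorem specDensity_eq_zero {ω : ℝ} (hω : 0 < ω) :
    ∀ᵐ ξ, ω / Real.pi < ‖ξ‖ → specDensity ω ξ = 0 := by
  have h := Measure.setLIntegral_rnDeriv (freqMeasure_absolutelyContinuous hω)
    {ξ | ω / Real.pi < ‖ξ‖}
  have hm : MeasurableSet {ξ : Plane | ω / Real.pi < ‖ξ‖} :=
    measurableSet_lt measurable_const measurable_norm
  rw [freqMeasure_norm_gt hω, lintegral_eq_zero_iff (Measure.measurable_rnDeriv _ _),
    Filter.EventuallyEq, ae_restrict_iff' hm] at h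
  filter_upwards [h] with ξ hξ hlt
  simp [specDensity, hξ hlt]

theorem cosAngle_neg (ω : ℝ) (ξ : Plane) : cosAngle ω (-ξ) = cosAngle ω ξ := by
  simp [cosAngle]

theorem cosAngle_freq {ω : ℝ} (hω : 0 < ω) (θ φ : ℝ) :
    cosAngle ω (freq ω (θ, φ)) = inner ℝ (dir θ) (dir φ) := by
  have h := norm_sub_sq_real (dir θ) (dir φ)
  rw [norm_dir, norm_dir] at h
  have hπ := Real.pi_pos
  rw [cosAngle, freq, norm_smul, mul_pow, h, Real.norm_of_nonneg (by positivity)]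
  field_simp
  ring

theorem abs_cosAngle_le_one {ω : ℝ} (hω : 0 < ω) {ξ : Plane} (h : ‖ξ‖ ≤ ω / Real.pi) :
    |cosAngle ω ξ| ≤ 1 := by
  have hπ := Real.pi_pos
  have h1 : 2 * Real.pi / ω * ‖ξ‖ ≤ 2 := by
    calc 2 * Real.pi / ω * ‖ξ‖ ≤ 2 * Real.pi / ω * (ω / Real.pi) := by gcongr
      _ = 2 := by field_simp
  have h2 : (2 * Real.pi / ω * ‖ξ‖) ^ 2 ≤ 2 ^ 2 := by gcongr
  rw [cosAngle, ← mul_pow, abs_le]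
  constructor <;> nlinarith [sq_nonneg (2 * Real.pi / ω * ‖ξ‖)]

/-- On the support of the spectral density `x̂·ζ` is a cosine. -/
theorem abs_filterSpectrum_le {ω : ℝ} (hω : 0 < ω) (j j' : Fin 2) :
    ∀ᵐ ξ, |filterSpectrum ω j j' ξ| ≤ specDensity ω ξ := by
  filter_upwards [specDensity_eq_zero hω] with ξ hξ
  rw [filterSpectrum, abs_mul, abs_of_nonneg (specDensity_nonneg ω ξ), abs_mul, abs_pow, abs_pow,
    abs_neg]
  rcases lt_or_ge (ω / Real.pi) ‖ξ‖ with h | h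
  · simp [hξ h]
  · have h1 := abs_cosAngle_le_one hω h
    exact mul_le_of_le_one_left (specDensity_nonneg ω ξ) (mul_le_one₀
      (pow_le_one₀ (abs_nonneg _) h1) (by positivity) (pow_le_one₀ (abs_nonneg _) h1))

theorem integrable_filterSpectrum {ω : ℝ} (hω : 0 < ω) (j j' : Fin 2) :
    Integrable (filterSpectrum ω j j') :=
  (integrable_specDensity ω).mono' (measurable_filterSpectrum ω j j').aestronglyMeasurable
    (abs_filterSpectrum_le hω j j')

theorem filterSpectrum_neg (ω : ℝ) (j j' : Fin 2) :
    ∀ᵐ ξ, filterSpectrum ω j j' (-ξ) = filterSpectrum ω j j' ξ := by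
  filter_upwards [specDensity_neg ω] with ξ hξ
  rw [filterSpectrum, filterSpectrum, hξ, cosAngle_neg]

theorem filterSpectrum_eq_zero {ω : ℝ} (hω : 0 < ω) (j j' : Fin 2) :
    ∀ᵐ ξ, ω / Real.pi < ‖ξ‖ → filterSpectrum ω j j' ξ = 0 := by
  filter_upwards [specDensity_eq_zero hω] with ξ hξ h
  rw [filterSpectrum, hξ h, mul_zero]

theorem integral_abs_filterSpectrum_le {ω : ℝ} (hω : 0 < ω) (j j' : Fin 2) :
    ∫ ξ, |filterSpectrum ω j j' ξ| ≤ ‖farFieldConst ω‖ ^ 2 * (4 * Real.pi ^ 2) := by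
  rw [← integral_specDensity hω]
  exact integral_mono_ae (integrable_filterSpectrum hω j j').abs (integrable_specDensity ω)
    (abs_filterSpectrum_le hω j j')

/-- The filters are the cosine transforms of their spectra. -/
theorem gFilter_eq_cosTransform {ω : ℝ} (hω : 0 < ω) (j j' : Fin 2) (y : Plane) :
    gFilter ω j j' y = cosTransform (filterSpectrum ω j j') y := by
  have hcont : Continuous fun ξ : Plane => (-cosAngle ω ξ) ^ (1 - (j : ℕ)) *
      (-cosAngle ω ξ) ^ (1 - (j' : ℕ)) * Real.cos (2 * Real.pi * inner ℝ ξ y) := by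
    have := continuous_cosAngle ω
    fun_prop
  have h := integral_specDensity_smul hω hcont
  have hl : cosTransform (filterSpectrum ω j j') y = ∫ ξ, specDensity ω ξ •
      ((-cosAngle ω ξ) ^ (1 - (j : ℕ)) * (-cosAngle ω ξ) ^ (1 - (j' : ℕ)) *
        Real.cos (2 * Real.pi * inner ℝ ξ y)) := by
    refine integral_congr_ae (.of_forall fun ξ => ?_)
    simp only [filterSpectrum, smul_eq_mul]
    ring
  rw [hl, h]
  change filterFun ω j j' y = _
  rw [filterFun, smul_eq_mul, mul_comm ((-1 : ℝ) ^ _), mul_assoc,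
    ← intervalIntegral.integral_const_mul]
  congr 2
  ext θ
  rw [← intervalIntegral.integral_const_mul]
  congr 1
  ext φ
  have hphase : 2 * Real.pi * inner ℝ (freq ω (θ, φ)) y = ω * inner ℝ (dir θ - dir φ) y := by
    rw [freq, real_inner_smul_left]
    field_simp [Real.pi_ne_zero]
  have hsign : ∀ c : ℝ, (-c) ^ (1 - (j : ℕ)) * (-c) ^ (1 - (j' : ℕ)) =
      (-1) ^ ((j : ℕ) + (j' : ℕ)) * c ^ (2 - (j : ℕ) - (j' : ℕ)) := fun c => by
    fin_cases j <;> fin_cases j' <;> simp [sq]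
  rw [cosAngle_freq hω, hphase, filterIntegrand, hsign, mul_assoc]

/-! ### The normal operator is a convolution -/

theorem cosTransform_sum {ι : Type*} (s : Finset ι) {b : ι → Plane → ℝ}
    (hb : ∀ i ∈ s, Integrable (b i)) (x : Plane) :
    cosTransform (fun ξ => ∑ i ∈ s, b i ξ) x = ∑ i ∈ s, cosTransform (b i) x := by
  unfold cosTransform
  rw [← integral_finsetSum s fun i hi => integrable_mul_cos (hb i hi) x]
  simp only [Finset.sum_mul]

theorem cosTransform_neg (b : Plane → ℝ) (x : Plane) :
    cosTransform (fun ξ => -b ξ) x = -cosTransform b x := by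
  simp only [cosTransform, neg_mul, integral_neg]

/-- The Fourier transform of `u`, restricted to the unit disc. -/
noncomputable abbrev discFourier (u : Plane → ℂ) : Plane → ℂ :=
  VectorFourier.fourierIntegral Real.fourierChar (volume.restrict (Metric.ball (0 : Plane) 1))
    (innerₗ Plane) u

theorem continuous_discFourier {u : Plane → ℂ}
    (hu : Integrable u (volume.restrict (Metric.ball (0 : Plane) 1))) :
    Continuous (discFourier u) :=
  VectorFourier.fourierIntegral_continuous Real.continuous_fourierChar
    (by simpa using continuous_inner) hu

/-- The forward operator factors through the Fourier transforms of its arguments, evaluated at the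
frequency `(ω / 2π) (x̂ - ζ)`. -/
theorem forward_eq {ω : ℝ} (hω : 0 < ω) (u : Fin 2 → Plane → ℂ) (θ φ : ℝ) :
    forward ω u θ φ = farFieldConst ω *
      ∑ j : Fin 2, (((-cosAngle ω (freq ω (θ, φ))) ^ (1 - (j : ℕ)) : ℝ) : ℂ) *
        discFourier (u j) (freq ω (θ, φ)) := by
  have hF : ∀ w : Plane → ℂ, discFourier w (freq ω (θ, φ)) =
      ∫ y in Metric.ball (0 : Plane) 1,
        Complex.exp (Complex.I * (ω * inner ℝ (dir φ - dir θ) y : ℝ)) * w y := fun w => by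
    refine integral_congr_ae (.of_forall fun y => ?_)
    have hphase : 2 * Real.pi * -inner ℝ y (freq ω (θ, φ)) = ω * inner ℝ (dir φ - dir θ) y := by
      rw [freq, real_inner_smul_right, real_inner_comm, ← neg_sub (dir φ), inner_neg_left]
      field_simp [Real.pi_ne_zero]
    simp only [Circle.smul_def, Real.fourierChar_apply, innerₗ_apply_apply, smul_eq_mul, hphase,
      mul_comm Complex.I]
  rw [forward, Fin.sum_univ_two, hF, hF, cosAngle_freq hω]
  simp only [Fin.val_zero, Fin.val_one, mul_assoc, integral_const_mul]
  simp

theorem integral_conj_forward_mul {ω : ℝ} (hω : 0 < ω) {u v : Fin 2 → Plane → ℂ}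
    (hu : ∀ j, Integrable (u j) (volume.restrict (Metric.ball (0 : Plane) 1)))
    (hv : ∀ j, Integrable (v j) (volume.restrict (Metric.ball (0 : Plane) 1))) :
    ∫ θ in (0 : ℝ)..(2 * Real.pi), ∫ φ in (0 : ℝ)..(2 * Real.pi),
        conj (forward ω u θ φ) * forward ω v θ φ =
      ∑ j, ∑ j', ∫ y in Metric.ball (0 : Plane) 1, conj (u j y) *
        ∫ y' in Metric.ball (0 : Plane) 1, (gFilter ω j j' (y - y') : ℂ) * v j' y' := by
  set s : Fin 2 → Plane → ℝ := fun j ξ => (-cosAngle ω ξ) ^ (1 - (j : ℕ)) with hs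
  have hsc : ∀ j, Continuous (s j) := fun j => (continuous_cosAngle ω).neg.pow _
  have hcont : Continuous fun ξ => conj (∑ j, (s j ξ : ℂ) * discFourier (u j) ξ) *
      ∑ j, (s j ξ : ℂ) * discFourier (v j) ξ := by
    have h1 := fun j => continuous_discFourier (hu j)
    have h2 := fun j => continuous_discFourier (hv j)
    fun_prop
  have h := integral_specDensity_smul hω hcont
  have hl : ∀ θ φ, conj (forward ω u θ φ) * forward ω v θ φ = (‖farFieldConst ω‖ ^ 2 : ℝ) •
      (conj (∑ j, (s j (freq ω (θ, φ)) : ℂ) * discFourier (u j) (freq ω (θ, φ))) *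
      ∑ j, (s j (freq ω (θ, φ)) : ℂ) * discFourier (v j) (freq ω (θ, φ))) := fun θ φ => by
    rw [forward_eq hω, forward_eq hω, map_mul, Complex.real_smul, Complex.ofReal_pow,
      ← Complex.conj_mul']
    ring
  simp only [hl, intervalIntegral.integral_smul]
  rw [← h]
  have hsplit : ∀ ξ, specDensity ω ξ • (conj (∑ j, (s j ξ : ℂ) * discFourier (u j) ξ) *
      ∑ j, (s j ξ : ℂ) * discFourier (v j) ξ) = ∑ j, ∑ j', conj (discFourier (u j) ξ) *
        ((filterSpectrum ω j j' ξ : ℂ) * discFourier (v j') ξ) := fun ξ => by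
    simp only [Fin.sum_univ_two, filterSpectrum, map_add, map_mul, Complex.conj_ofReal,
      Complex.real_smul, hs]
    push_cast
    ring
  have hint : ∀ j j', Integrable fun ξ => conj (discFourier (u j) ξ) *
      ((filterSpectrum ω j j' ξ : ℂ) * discFourier (v j') ξ) := fun j j' => by
    refine Integrable.bdd_mul (c := ∫ x in Metric.ball (0 : Plane) 1, ‖u j x‖)
      (Integrable.mul_bdd (c := ∫ x in Metric.ball (0 : Plane) 1, ‖v j' x‖)
        (integrable_filterSpectrum hω j j').ofReal
        (continuous_discFourier (hv j')).aestronglyMeasurable (.of_forall fun ξ => ?_))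
      (Complex.continuous_conj.comp (continuous_discFourier (hu j))).aestronglyMeasurable
      (.of_forall fun ξ => ?_)
    · exact VectorFourier.norm_fourierIntegral_le_integral_norm _ _ _ _ _
    · rw [RCLike.norm_conj]
      exact VectorFourier.norm_fourierIntegral_le_integral_norm _ _ _ _ _
  simp only [hsplit]
  rw [integral_finsetSum _ fun j _ => integrable_finsetSum _ fun j' _ => hint j j']
  refine Finset.sum_congr rfl fun j _ => ?_
  rw [integral_finsetSum _ fun j' _ => hint j j']
  refine Finset.sum_congr rfl fun j' _ => ?_
  rw [integral_conj_fourierIntegral_mul (integrable_filterSpectrum hω j j')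
    (filterSpectrum_neg ω j j') _ (hu j) (hv j')]
  simp only [gFilter_eq_cosTransform hω]

theorem norm_density_smul_le {V : Type*} [NormedAddCommGroup V] [NormedSpace ℝ V]
    (k : Plane →ᵇ ℝ) (z : Plane) (w : V) : ‖k z • w‖ ≤ ‖k‖ * ‖w‖ := by
  rw [norm_smul]
  gcongr
  exact k.norm_coe_le_norm z

theorem integrable_density_smul {V : Type*} [NormedAddCommGroup V] [NormedSpace ℝ V]
    (k : Plane →ᵇ ℝ) {μ : Measure Plane} {f : Plane → V} (hf : Integrable f μ) (x : Plane) :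
    Integrable (fun y => k (x - y) • f y) μ :=
  hf.bdd_smul ‖k‖ (by fun_prop : Continuous fun y => k (x - y)).aestronglyMeasurable
    (.of_forall fun y => k.norm_coe_le_norm _)

theorem continuous_integral_density_smul {V : Type*} [NormedAddCommGroup V] [NormedSpace ℝ V]
    (k : Plane →ᵇ ℝ) {μ : Measure Plane} {f : Plane → V} (hf : Integrable f μ) :
    Continuous fun x => ∫ y, k (x - y) • f y ∂μ :=
  continuous_of_dominated (bound := fun y => ‖k‖ * ‖f y‖)
    (fun x => (integrable_density_smul k hf x).aestronglyMeasurable)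
    (fun x => .of_forall fun y => norm_density_smul_le k _ _) (hf.norm.const_mul _)
    (.of_forall fun y => by fun_prop)

theorem integrable_conj_mul_integral (k : Plane →ᵇ ℝ) {μ : Measure Plane} {u v : Plane → ℂ}
    (hu : Integrable u μ) (hv : Integrable v μ) :
    Integrable (fun y => conj (u y) * ∫ y', k (y - y') • v y' ∂μ) μ := by
  have hu' : Integrable (fun y => conj (u y)) μ := hu.congr'
    (Complex.continuous_conj.comp_aestronglyMeasurable hu.aestronglyMeasurable)
    (.of_forall fun y => by simp)
  refine hu'.mul_bdd (c := ‖k‖ * ∫ y', ‖v y'‖ ∂μ)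
    (continuous_integral_density_smul k hv).aestronglyMeasurable (.of_forall fun y => ?_)
  rw [← integral_const_mul]
  exact norm_integral_le_of_norm_le (hv.norm.const_mul _)
    (.of_forall fun y' => norm_density_smul_le k _ _)

theorem normalForm_eq {ω : Fin 2 → ℝ} (hω : ∀ i, 0 < ω i) (α : ℝ) {u v : Fin 2 → Plane → ℂ}
    (hu : ∀ j, MemLp (u j) 2 (volume.restrict (Metric.ball (0 : Plane) 1)))
    (hv : ∀ j, MemLp (v j) 2 (volume.restrict (Metric.ball (0 : Plane) 1))) :
    normalForm ω α u v = ∑ j, ∫ y in Metric.ball (0 : Plane) 1, conj (u j y) *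
      ∑ j', (gKernel ω α j j').convOn (Metric.ball (0 : Plane) 1) (v j') y := by
  have : IsFiniteMeasure (volume.restrict (Metric.ball (0 : Plane) 1)) :=
    ⟨by rw [Measure.restrict_apply_univ]; exact measure_ball_lt_top⟩
  have hu1 : ∀ j, Integrable (u j) (volume.restrict (Metric.ball (0 : Plane) 1)) :=
    fun j => (hu j).integrable (by norm_num)
  have hv1 : ∀ j, Integrable (v j) (volume.restrict (Metric.ball (0 : Plane) 1)) :=
    fun j => (hv j).integrable (by norm_num)
  have huv : ∀ j, Integrable (fun y => conj (u j y) * v j y)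
      (volume.restrict (Metric.ball (0 : Plane) 1)) := fun j => by
    have h : MemLp (fun y => conj (u j y)) 2 (volume.restrict (Metric.ball (0 : Plane) 1)) :=
      (hu j).star
    exact h.integrable_mul (hv j)
  have hterm := fun i j j' => integrable_conj_mul_integral (gFilter (ω i) j j') (hu1 j) (hv1 j')
  have hconv : ∀ j y, conj (u j y) *
      ∑ j', (gKernel ω α j j').convOn (Metric.ball (0 : Plane) 1) (v j') y =
      (α : ℂ) * (conj (u j y) * v j y) + ∑ i, ∑ j', conj (u j y) *
        ∫ y' in Metric.ball (0 : Plane) 1, gFilter (ω i) j j' (y - y') • v j' y' := by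
    intro j y
    have hd : ∀ j', ∫ y' in Metric.ball (0 : Plane) 1,
        (gKernel ω α j j').density (y - y') • v j' y' = ∑ i, ∫ y' in Metric.ball (0 : Plane) 1,
          gFilter (ω i) j j' (y - y') • v j' y' := fun j' => by
      rw [← integral_finsetSum _ fun i _ => integrable_density_smul _ (hv1 j') y]
      simp [gKernel, add_mul]
    have ha : ∑ j', (gKernel ω α j j').atom • v j' y = (α : ℂ) * v j y := by
      simp [gKernel]
    simp only [Kernel.convOn, hd, Finset.sum_add_distrib, ha, mul_add]
    rw [Finset.sum_comm]
    simp only [Finset.mul_sum]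
    ring
  have hR : ∀ j, ∫ y in Metric.ball (0 : Plane) 1, conj (u j y) *
      ∑ j', (gKernel ω α j j').convOn (Metric.ball (0 : Plane) 1) (v j') y =
      (α : ℂ) * (∫ y in Metric.ball (0 : Plane) 1, conj (u j y) * v j y) +
        ∑ i, ∑ j', ∫ y in Metric.ball (0 : Plane) 1, conj (u j y) *
        ∫ y' in Metric.ball (0 : Plane) 1, gFilter (ω i) j j' (y - y') • v j' y' := by
    intro j
    simp only [hconv]
    rw [integral_add ((huv j).const_mul _) (integrable_finsetSum _ fun i _ =>
      integrable_finsetSum _ fun j' _ => hterm i j j'), integral_const_mul,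
      integral_finsetSum _ fun i _ => integrable_finsetSum _ fun j' _ => hterm i j j']
    congr 1
    exact Finset.sum_congr rfl fun i _ => integral_finsetSum _ fun j' _ => hterm i j j'
  simp only [hR, normalForm, integral_conj_forward_mul (hω _) hu1 hv1, Finset.sum_add_distrib,
    ← Finset.mul_sum, Complex.real_smul]
  rw [Finset.sum_comm, add_comm]

/-! ### The symbol -/

/-- The Fourier transform of the matrix kernel `𝐠`. -/
noncomputable def symbol (ω : Fin 2 → ℝ) (α : ℝ) (ξ : Plane) : Matrix (Fin 2) (Fin 2) ℝ :=
  Matrix.of fun j j' => (if j = j' then α else 0) + ∑ i, filterSpectrum (ω i) j j' ξ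

theorem integrable_sum_filterSpectrum {ω : Fin 2 → ℝ} (hω : ∀ i, 0 < ω i) (j j' : Fin 2) :
    Integrable fun ξ => ∑ i, filterSpectrum (ω i) j j' ξ :=
  integrable_finsetSum _ fun i _ => integrable_filterSpectrum (hω i) j j'

theorem sum_filterSpectrum_neg (ω : Fin 2 → ℝ) (j j' : Fin 2) :
    ∀ᵐ ξ, ∑ i, filterSpectrum (ω i) j j' (-ξ) = ∑ i, filterSpectrum (ω i) j j' ξ := by
  filter_upwards [ae_all_iff.2 fun i => filterSpectrum_neg (ω i) j j'] with ξ hξ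
  simp only [hξ]

theorem gKernel_density_eq {ω : Fin 2 → ℝ} (hω : ∀ i, 0 < ω i) (α : ℝ) (j j' : Fin 2)
    (x : Plane) : (gKernel ω α j j').density x =
      cosTransform (fun ξ => ∑ i, filterSpectrum (ω i) j j' ξ) x := by
  rw [cosTransform_sum _ fun i _ => integrable_filterSpectrum (hω i) j j']
  simp [gKernel, gFilter_eq_cosTransform (hω _)]

theorem represents_symbol {ω : Fin 2 → ℝ} (hω : ∀ i, 0 < ω i) (α : ℝ) (j j' : Fin 2) :
    Represents (fun ξ => symbol ω α ξ j j') (𝓕 (gKernel ω α j j').toDistribution) :=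
  represents_fourier_toDistribution _ (integrable_sum_filterSpectrum hω j j')
    (sum_filterSpectrum_neg ω j j') (gKernel_density_eq hω α j j')

theorem represents_neg_symbol {ω : Fin 2 → ℝ} (hω : ∀ i, 0 < ω i) (α : ℝ) (j j' : Fin 2) :
    Represents (fun ξ => -symbol ω α ξ j j') (𝓕 (gKernel ω α j j').neg.toDistribution) := by
  have h := represents_fourier_toDistribution (gKernel ω α j j').neg
    (b := fun ξ => -∑ i, filterSpectrum (ω i) j j' ξ)
    (integrable_sum_filterSpectrum hω j j').neg
    (by filter_upwards [sum_filterSpectrum_neg ω j j'] with ξ hξ; rw [hξ])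
    (fun x => by
      rw [cosTransform_neg, ← gKernel_density_eq hω α]
      rfl)
  convert h using 2
  simp only [symbol, Matrix.of_apply, Kernel.neg, gKernel]
  ring

theorem isSymbol_symbol {ω : Fin 2 → ℝ} (hω : ∀ i, 0 < ω i) (α : ℝ) :
    IsSymbol ω α (symbol ω α) := fun j j' =>
  ⟨measurable_const.add (Finset.measurable_sum _ fun i _ =>
    measurable_filterSpectrum (ω i) j j'), represents_symbol hω α j j'⟩

theorem represents_adjugate {ω : Fin 2 → ℝ} (hω : ∀ i, 0 < ω i) (α : ℝ) (a b : Fin 2) :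
    Represents (fun ξ => (symbol ω α ξ).adjugate a b) (𝓕 (g₁Kernel ω α a b).toDistribution) := by
  simp only [Matrix.adjugate_fin_two]
  fin_cases a <;> fin_cases b
  · exact represents_symbol hω α 1 1
  · exact represents_neg_symbol hω α 0 1
  · exact represents_neg_symbol hω α 1 0
  · exact represents_symbol hω α 0 0

/-- The trace of the symbol of `F*F`. -/
noncomputable def symbolTrace (ω : Fin 2 → ℝ) (ξ : Plane) : ℝ :=
  ∑ i, (filterSpectrum (ω i) 0 0 ξ + filterSpectrum (ω i) 1 1 ξ)

/-- By Lagrange's identity `det (αI + M) = α² + α tr M + det M` with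
`det M = a₀ a₁ (p₀ - p₁)²`, for the symbol `M` of `F*F`. -/
theorem det_symbol (ω : Fin 2 → ℝ) (α : ℝ) (ξ : Plane) :
    (symbol ω α ξ).det = α ^ 2 + α * symbolTrace ω ξ +
      specDensity (ω 0) ξ * specDensity (ω 1) ξ *
        (cosAngle (ω 0) ξ - cosAngle (ω 1) ξ) ^ 2 := by
  rw [Matrix.det_fin_two]
  simp only [symbol, symbolTrace, Matrix.of_apply, Fin.sum_univ_two, filterSpectrum]
  simp
  ring

theorem symbolTrace_nonneg (ω : Fin 2 → ℝ) (ξ : Plane) : 0 ≤ symbolTrace ω ξ := by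
  have h := fun i => specDensity_nonneg (ω i) ξ
  refine Finset.sum_nonneg fun i _ => ?_
  simp only [filterSpectrum]
  simp only [Fin.val_zero, Fin.val_one, tsub_zero, tsub_self, pow_one, pow_zero, neg_mul_neg]
  exact add_nonneg (mul_nonneg (mul_self_nonneg _) (h i)) (mul_nonneg (by norm_num) (h i))

theorem sq_le_det_symbol (ω : Fin 2 → ℝ) {α : ℝ} (hα : 0 < α) (ξ : Plane) :
    α ^ 2 ≤ (symbol ω α ξ).det := by
  rw [det_symbol]
  have h := fun i => specDensity_nonneg (ω i) ξ
  have h1 := mul_nonneg hα.le (symbolTrace_nonneg ω ξ)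
  have h2 := mul_nonneg (mul_nonneg (h 0) (h 1)) (sq_nonneg (cosAngle (ω 0) ξ - cosAngle (ω 1) ξ))
  linarith

/-! ### The inverse of the determinant -/

/-- The spectrum `α⁻² - 1 / det` of the bounded part `g_{2,α}` of the kernel `g₂`. -/
noncomputable def invSpectrum (ω : Fin 2 → ℝ) (α : ℝ) (ξ : Plane) : ℝ :=
  (α ^ 2)⁻¹ - ((symbol ω α ξ).det)⁻¹

theorem invSpectrum_nonneg (ω : Fin 2 → ℝ) {α : ℝ} (hα : 0 < α) (ξ : Plane) :
    0 ≤ invSpectrum ω α ξ :=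
  sub_nonneg.2 (inv_anti₀ (by positivity) (sq_le_det_symbol ω hα ξ))

theorem invSpectrum_le (ω : Fin 2 → ℝ) {α : ℝ} (hα : 0 < α) (ξ : Plane) :
    invSpectrum ω α ξ ≤ (α ^ 2)⁻¹ :=
  sub_le_self _ (inv_nonneg.2 ((sq_nonneg α).trans (sq_le_det_symbol ω hα ξ)))

/-- The bound that is integrable uniformly in large `α`. -/
theorem mul_invSpectrum_le (ω : Fin 2 → ℝ) {α : ℝ} (hα : 0 < α) (ξ : Plane) :
    α * invSpectrum ω α ξ ≤ (α ^ 2)⁻¹ * symbolTrace ω ξ := by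
  have hdet := sq_le_det_symbol ω hα ξ
  have hpos : 0 < (symbol ω α ξ).det := lt_of_lt_of_le (by positivity) hdet
  have hT := symbolTrace_nonneg ω ξ
  have hX : specDensity (ω 0) ξ * specDensity (ω 1) ξ *
      (cosAngle (ω 0) ξ - cosAngle (ω 1) ξ) ^ 2 ≤ symbolTrace ω ξ ^ 2 := by
    have h0 := specDensity_nonneg (ω 0) ξ
    have h1 := specDensity_nonneg (ω 1) ξ
    simp only [symbolTrace, Fin.sum_univ_two, filterSpectrum]
    simp only [Fin.val_zero, Fin.val_one, tsub_zero, tsub_self, pow_one, pow_zero, neg_mul_neg,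
      one_mul]
    generalize specDensity (ω 0) ξ = a at *
    generalize specDensity (ω 1) ξ = b at *
    generalize cosAngle (ω 0) ξ = p
    generalize cosAngle (ω 1) ξ = q
    have hpq : (p - q) ^ 2 ≤ (1 + p ^ 2) * (1 + q ^ 2) := by nlinarith [sq_nonneg (1 + p * q)]
    have hP : 0 ≤ a * (1 + p ^ 2) := by positivity
    have hQ : 0 ≤ b * (1 + q ^ 2) := by positivity
    calc a * b * (p - q) ^ 2 ≤ a * b * ((1 + p ^ 2) * (1 + q ^ 2)) := by gcongr
      _ ≤ (a * (1 + p ^ 2) + b * (1 + q ^ 2)) ^ 2 := by nlinarith [mul_nonneg hP hQ]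
      _ = _ := by ring
  have hkey : α * ((symbol ω α ξ).det - α ^ 2) ≤ symbolTrace ω ξ * (symbol ω α ξ).det := by
    rw [det_symbol] at hdet ⊢
    nlinarith [mul_le_mul_of_nonneg_left hX hα.le, mul_nonneg hT (sub_nonneg.2 hdet),
      mul_nonneg hT (mul_nonneg hα.le hT)]
  rw [invSpectrum, inv_sub_inv (by positivity) hpos.ne', mul_div_assoc',
    div_le_iff₀ (by positivity)]
  calc _ ≤ symbolTrace ω ξ * (symbol ω α ξ).det := hkey
    _ = _ := by field_simp

theorem measurable_invSpectrum (ω : Fin 2 → ℝ) (α : ℝ) : Measurable (invSpectrum ω α) := by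
  have hm : ∀ j j', Measurable fun ξ => symbol ω α ξ j j' := fun j j' =>
    measurable_const.add (Finset.measurable_sum _ fun i _ => measurable_filterSpectrum (ω i) j j')
  unfold invSpectrum
  simp only [Matrix.det_fin_two]
  exact measurable_const.sub (((hm 0 0).mul (hm 1 1)).sub ((hm 0 1).mul (hm 1 0))).inv

theorem invSpectrum_neg (ω : Fin 2 → ℝ) (α : ℝ) :
    ∀ᵐ ξ, invSpectrum ω α (-ξ) = invSpectrum ω α ξ := by
  filter_upwards [ae_all_iff.2 fun j => ae_all_iff.2 fun j' => sum_filterSpectrum_neg ω j j']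
    with ξ hξ
  simp only [invSpectrum, symbol, hξ]

theorem invSpectrum_eq_zero {ω : Fin 2 → ℝ} (hω : ∀ i, 0 < ω i) {R : ℝ}
    (hR : ∀ i, ω i / Real.pi ≤ R) (α : ℝ) :
    ∀ᵐ ξ, R < ‖ξ‖ → invSpectrum ω α ξ = 0 := by
  filter_upwards [ae_all_iff.2 fun i => specDensity_eq_zero (hω i)] with ξ hξ hlt
  have h := fun i => hξ i ((hR i).trans_lt hlt)
  rw [invSpectrum, det_symbol]
  simp [symbolTrace, filterSpectrum, h]

theorem integrable_indicator_closedBall (R c : ℝ) :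
    Integrable ((Metric.closedBall (0 : Plane) R).indicator fun _ => c) :=
  (integrableOn_const measure_closedBall_lt_top.ne).integrable_indicator
    Metric.isClosed_closedBall.measurableSet

theorem abs_invSpectrum_le_indicator {ω : Fin 2 → ℝ} (hω : ∀ i, 0 < ω i) {R : ℝ}
    (hR : ∀ i, ω i / Real.pi ≤ R) {α : ℝ} (hα : 0 < α) :
    ∀ᵐ ξ, |invSpectrum ω α ξ| ≤
      (Metric.closedBall (0 : Plane) R).indicator (fun _ => (α ^ 2)⁻¹) ξ := by
  filter_upwards [invSpectrum_eq_zero hω hR α] with ξ hξ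
  rw [abs_of_nonneg (invSpectrum_nonneg ω hα ξ)]
  by_cases h : ξ ∈ Metric.closedBall (0 : Plane) R
  · rw [Set.indicator_of_mem h]
    exact invSpectrum_le ω hα ξ
  · rw [Set.indicator_of_notMem h, hξ (by simpa using h)]

theorem integrable_invSpectrum {ω : Fin 2 → ℝ} (hω : ∀ i, 0 < ω i) {R : ℝ}
    (hR : ∀ i, ω i / Real.pi ≤ R) {α : ℝ} (hα : 0 < α) : Integrable (invSpectrum ω α) :=
  (integrable_indicator_closedBall R _).mono' (measurable_invSpectrum ω α).aestronglyMeasurable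
    (abs_invSpectrum_le_indicator hω hR hα)

theorem integral_abs_invSpectrum_le {ω : Fin 2 → ℝ} (hω : ∀ i, 0 < ω i) {R : ℝ} (hR0 : 0 ≤ R)
    (hR : ∀ i, ω i / Real.pi ≤ R) {α : ℝ} (hα : 0 < α) :
    ∫ ξ, |invSpectrum ω α ξ| ≤ (α ^ 2)⁻¹ * (Real.pi * R ^ 2) := by
  refine (integral_mono_ae (integrable_invSpectrum hω hR hα).abs
    (integrable_indicator_closedBall R _) (abs_invSpectrum_le_indicator hω hR hα)).trans_eq ?_
  rw [integral_indicator Metric.isClosed_closedBall.measurableSet, setIntegral_const,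
    Measure.real, EuclideanSpace.volume_closedBall_fin_two, smul_eq_mul, mul_comm]
  congr 1
  rw [ENNReal.toReal_mul, ENNReal.toReal_pow, ENNReal.toReal_ofReal hR0, mul_comm,
    ENNReal.toReal_ofReal Real.pi_pos.le]

theorem integral_abs_invSpectrum_mul_le {ω : Fin 2 → ℝ} (hω : ∀ i, 0 < ω i) {R : ℝ}
    (hR : ∀ i, ω i / Real.pi ≤ R) {α : ℝ} (hα : 0 < α) :
    α * ∫ ξ, |invSpectrum ω α ξ| ≤
      (α ^ 2)⁻¹ * (8 * Real.pi ^ 2 * ∑ i, ‖farFieldConst (ω i)‖ ^ 2) := by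
  have hT : Integrable (symbolTrace ω) := integrable_finsetSum _ fun i _ =>
    (integrable_filterSpectrum (hω i) 0 0).add (integrable_filterSpectrum (hω i) 1 1)
  have hTle : ∫ ξ, symbolTrace ω ξ ≤ 8 * Real.pi ^ 2 * ∑ i, ‖farFieldConst (ω i)‖ ^ 2 := by
    unfold symbolTrace
    rw [integral_finsetSum _ fun i _ => (integrable_filterSpectrum (hω i) 0 0).fun_add
      (integrable_filterSpectrum (hω i) 1 1), Finset.mul_sum]
    refine Finset.sum_le_sum fun i _ => ?_
    rw [integral_add (integrable_filterSpectrum (hω i) 0 0) (integrable_filterSpectrum (hω i) 1 1)]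
    have h0 := (le_abs_self _).trans (abs_integral_le_integral_abs.trans
      (integral_abs_filterSpectrum_le (hω i) 0 0))
    have h1 := (le_abs_self _).trans (abs_integral_le_integral_abs.trans
      (integral_abs_filterSpectrum_le (hω i) 1 1))
    linarith
  rw [← integral_const_mul]
  calc ∫ ξ, α * |invSpectrum ω α ξ| ≤ ∫ ξ, (α ^ 2)⁻¹ * symbolTrace ω ξ := by
        refine integral_mono ((integrable_invSpectrum hω hR hα).abs.const_mul α)
          (hT.const_mul _) fun ξ => ?_
        simp only [abs_of_nonneg (invSpectrum_nonneg ω hα ξ)]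
        exact mul_invSpectrum_le ω hα ξ
    _ ≤ _ := by rw [integral_const_mul]; gcongr

/-- The cosine transform as a bounded continuous function. -/
noncomputable def cosTransformBounded {b : Plane → ℝ} (hb : Integrable b) : Plane →ᵇ ℝ :=
  BoundedContinuousFunction.ofNormedAddCommGroup (cosTransform b) (continuous_cosTransform hb)
    _ (abs_cosTransform_le hb)

theorem represents_inv_det {ω : Fin 2 → ℝ} {α : ℝ} (hb : Integrable (invSpectrum ω α)) :
    Represents (fun ξ => ((symbol ω α ξ).det)⁻¹)
      (𝓕 (Kernel.mk (α ^ 2)⁻¹ (-cosTransformBounded hb)).toDistribution) := by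
  have h := represents_fourier_toDistribution (Kernel.mk (α ^ 2)⁻¹ (-cosTransformBounded hb))
    (b := fun ξ => -invSpectrum ω α ξ) hb.neg
    (by filter_upwards [invSpectrum_neg ω α] with ξ hξ; rw [hξ])
    (fun x => by rw [cosTransform_neg]; rfl)
  convert h using 2
  simp [invSpectrum]

/-! ### Quadrature on the square -/

theorem measurableSet_cell {n : ℕ} (i j : Fin n) : MeasurableSet (cell i j) := by
  have h : ∀ k : Fin 2, Measurable fun x : Plane => x k := fun k => by fun_prop
  exact (h 0 measurableSet_Ico).inter (h 1 measurableSet_Ico)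

/-- The coordinate on a side of the square determines the index of the cell. -/
theorem mem_Ico_cell_iff {n : ℕ} (hn : 0 < n) (i : ℕ) (t : ℝ) :
    t ∈ Set.Ico (2 * (i : ℝ) / n - 1) (2 * ((i : ℝ) + 1) / n - 1) ↔
      -1 ≤ t ∧ ⌊(t + 1) * n / 2⌋₊ = i := by
  have hn' : (0 : ℝ) < n := by exact_mod_cast hn
  constructor
  · rintro ⟨h1, h2⟩
    have h0 : 0 ≤ 2 * (i : ℝ) / n := by positivity
    rw [sub_le_iff_le_add, div_le_iff₀ hn'] at h1
    rw [lt_sub_iff_add_lt, lt_div_iff₀ hn'] at h2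
    have h3 : -1 ≤ t := by
      by_contra! h
      have := mul_neg_of_neg_of_pos (by linarith : t + 1 < 0) hn'
      have : (0 : ℝ) ≤ i := by positivity
      linarith
    refine ⟨h3, (Nat.floor_eq_iff (div_nonneg (mul_nonneg (by linarith) hn'.le) two_pos.le)).2
      ⟨by linarith, by linarith⟩⟩
  · rintro ⟨h1, h2⟩
    rw [Nat.floor_eq_iff (div_nonneg (mul_nonneg (by linarith) hn'.le) two_pos.le)] at h2
    rw [Set.mem_Ico, sub_le_iff_le_add, div_le_iff₀ hn', lt_sub_iff_add_lt, lt_div_iff₀ hn']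
    exact ⟨by linarith [h2.1], by linarith [h2.2]⟩

theorem eq_of_mem_cell {n : ℕ} (hn : 0 < n) {i j i' j' : Fin n} {x : Plane} (h : x ∈ cell i j)
    (h' : x ∈ cell i' j') : i = i' ∧ j = j' := by
  have h0 := (mem_Ico_cell_iff hn _ _).1 h.1
  have h1 := (mem_Ico_cell_iff hn _ _).1 h.2
  have h0' := (mem_Ico_cell_iff hn _ _).1 h'.1
  have h1' := (mem_Ico_cell_iff hn _ _).1 h'.2
  exact ⟨Fin.ext (h0.2.symm.trans h0'.2), Fin.ext (h1.2.symm.trans h1'.2)⟩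

theorem pieceConst_of_mem {n : ℕ} (hn : 0 < n) (A : Matrix (Fin n) (Fin n) ℝ) {i j : Fin n}
    {x : Plane} (h : x ∈ cell i j) : pieceConst A x = A i j := by
  rw [pieceConst, Finset.sum_eq_single i, Finset.sum_eq_single j, Set.indicator_of_mem h]
  · exact fun j' _ hj => Set.indicator_of_notMem (fun h' => hj (eq_of_mem_cell hn h' h).2) _
  · simp
  · exact fun i' _ hi => Finset.sum_eq_zero fun j' _ =>
      Set.indicator_of_notMem (fun h' => hi (eq_of_mem_cell hn h' h).1) _
  · simp

theorem abs_pieceConst_le {n : ℕ} (hn : 0 < n) {A : Matrix (Fin n) (Fin n) ℝ} {M : ℝ}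
    (hM0 : 0 ≤ M) (hM : ∀ i j, |A i j| ≤ M) (x : Plane) : |pieceConst A x| ≤ M := by
  by_cases h : ∃ i j : Fin n, x ∈ cell i j
  · obtain ⟨i, j, h⟩ := h
    rw [pieceConst_of_mem hn A h]
    exact hM i j
  · have h0 : pieceConst A x = 0 := Finset.sum_eq_zero fun i _ => Finset.sum_eq_zero fun j _ =>
      Set.indicator_of_notMem (fun hx => h ⟨i, j, hx⟩) _
    rwa [h0, abs_zero]

theorem measurable_pieceConst {n : ℕ} (A : Matrix (Fin n) (Fin n) ℝ) :
    Measurable (pieceConst A) :=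
  Finset.measurable_sum _ fun i _ => Finset.measurable_sum _ fun j _ =>
    measurable_const.indicator (measurableSet_cell i j)

theorem iUnion_cell {n : ℕ} (hn : 0 < n) :
    ⋃ p : Fin n × Fin n, cell p.1 p.2 = {x : Plane | ∀ k, x k ∈ Set.Ico (-1 : ℝ) 1} := by
  have hn' : (0 : ℝ) < n := by exact_mod_cast hn
  have hidx : ∀ t ∈ Set.Ico (-1 : ℝ) 1, ⌊(t + 1) * n / 2⌋₊ < n := fun t ht => by
    rw [Nat.floor_lt (div_nonneg (mul_nonneg (by linarith [ht.1]) hn'.le) two_pos.le),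
      div_lt_iff₀ two_pos, mul_comm]
    exact mul_lt_mul_of_pos_left (by linarith [ht.2]) hn'
  have hup : ∀ (i : Fin n) {t : ℝ}, t < 2 * ((i : ℝ) + 1) / n - 1 → t < 1 := fun i t ht => by
    have h1 : ((i : ℕ) : ℝ) + 1 ≤ n := by exact_mod_cast i.2
    have h2 : 2 * ((i : ℝ) + 1) / n ≤ 2 := by rw [div_le_iff₀ hn']; linarith
    linarith
  ext x
  simp only [Set.mem_iUnion, Prod.exists, Set.mem_ofPred_eq, Fin.forall_fin_two]
  constructor
  · rintro ⟨i, j, h0, h1⟩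
    exact ⟨⟨((mem_Ico_cell_iff hn _ _).1 h0).1, hup i h0.2⟩,
      ⟨((mem_Ico_cell_iff hn _ _).1 h1).1, hup j h1.2⟩⟩
  · rintro ⟨h0, h1⟩
    exact ⟨⟨_, hidx _ h0⟩, ⟨_, hidx _ h1⟩, (mem_Ico_cell_iff hn _ _).2 ⟨h0.1, rfl⟩,
      (mem_Ico_cell_iff hn _ _).2 ⟨h1.1, rfl⟩⟩

theorem iUnion_cell_ae_eq_square {n : ℕ} (hn : 0 < n) :
    (⋃ p : Fin n × Fin n, cell p.1 p.2 : Set Plane) =ᵐ[volume] square := by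
  have hmp := (EuclideanSpace.volume_preserving_symm_measurableEquiv_toLp
    (Fin 2)).quasiMeasurePreserving
  have h := hmp.preimage_ae_eq (Measure.univ_pi_Ico_ae_eq_Icc (f := fun _ : Fin 2 => (-1 : ℝ))
    (g := fun _ => 1) (μ := fun _ => volume))
  have e1 : {x : Plane | ∀ k, x k ∈ Set.Ico (-1 : ℝ) 1} =
      (MeasurableEquiv.toLp 2 (Fin 2 → ℝ)).symm ⁻¹' Set.univ.pi fun _ => Set.Ico (-1) 1 := by
    ext x; simp
  have e2 : square = (MeasurableEquiv.toLp 2 (Fin 2 → ℝ)).symm ⁻¹'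
      Set.Icc (fun _ => -1) fun _ => 1 := by
    ext x; simp [square, Pi.le_def, forall_and, and_and_and_comm]
  rw [iUnion_cell hn, e1, e2]
  exact h

theorem volume_cell {n : ℕ} (i j : Fin n) :
    volume.real (cell i j) = 4 / (n : ℝ) ^ 2 := by
  have hmp := EuclideanSpace.volume_preserving_symm_measurableEquiv_toLp (Fin 2)
  have hpre : cell i j = (MeasurableEquiv.toLp 2 (Fin 2 → ℝ)).symm ⁻¹' (Set.univ.pi fun k =>
      Set.Ico (![2 * (i : ℝ) / n - 1, 2 * (j : ℝ) / n - 1] k)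
        (![2 * ((i : ℝ) + 1) / n - 1, 2 * ((j : ℝ) + 1) / n - 1] k)) := by
    ext x
    simp [cell, Fin.forall_fin_two]
  have hlen : ∀ s : ℝ, 2 * (s + 1) / n - 1 - (2 * s / n - 1) = 2 / n := fun s => by ring
  rw [Measure.real, hpre, hmp.measure_preimage
    (MeasurableSet.univ_pi fun _ => measurableSet_Ico).nullMeasurableSet, Real.volume_pi_Ico,
    Fin.prod_univ_two]
  simp only [Matrix.cons_val_zero, Matrix.cons_val_one, hlen]
  rw [ENNReal.toReal_mul, ENNReal.toReal_ofReal (by positivity)]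
  ring

theorem volume_square : volume square = 4 := by
  have h := measure_congr (iUnion_cell_ae_eq_square one_pos)
  have hU : (⋃ p : Fin 1 × Fin 1, cell p.1 p.2 : Set Plane) = cell (0 : Fin 1) 0 := by
    ext x
    rw [Set.mem_iUnion, Prod.exists, Unique.exists_iff, Unique.exists_iff, Fin.default_eq_zero]
  have hc := volume_cell (0 : Fin 1) 0
  rw [hU] at h
  rw [Measure.real, h] at hc
  norm_num at hc
  have htop : volume square ≠ ⊤ := fun htop => by
    rw [htop, ENNReal.toReal_top] at hc
    norm_num at hc
  rw [← ENNReal.ofReal_toReal htop, hc]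
  norm_num

instance : IsFiniteMeasure (volume.restrict square) :=
  ⟨by rw [Measure.restrict_apply_univ, volume_square]; simp⟩

theorem abs_setIntegral_square_le {f : Plane → ℝ} {c : ℝ} (hf : ∀ y, |f y| ≤ c) :
    |∫ y in square, f y| ≤ 4 * c := by
  have h := norm_setIntegral_le_of_norm_le_const (μ := volume) (s := square) (f := f) (C := c)
    (by rw [volume_square]; simp) fun y _ => hf y
  rw [Measure.real, volume_square] at h
  simpa [mul_comm] using h

theorem integrableOn_cell {n : ℕ} (hn : 0 < n) {h : Plane → ℝ} (hint : IntegrableOn h square)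
    (p : Fin n × Fin n) : IntegrableOn h (cell p.1 p.2) :=
  (hint.congr_set_ae (iUnion_cell_ae_eq_square hn)).mono_set
    (Set.subset_iUnion (fun p : Fin n × Fin n => cell p.1 p.2) p)

theorem setIntegral_square_eq_sum {n : ℕ} (hn : 0 < n) {h : Plane → ℝ}
    (hint : IntegrableOn h square) :
    ∫ y in square, h y = ∑ p : Fin n × Fin n, ∫ y in cell p.1 p.2, h y := by
  have hdisj : Pairwise (Function.onFun Disjoint fun p : Fin n × Fin n => cell p.1 p.2) :=
    fun p q hpq => by
      rw [Function.onFun, Set.disjoint_left]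
      intro x hx hx'
      exact hpq (Prod.ext (eq_of_mem_cell hn hx hx').1 (eq_of_mem_cell hn hx hx').2)
  have hm : ∀ p : Fin n × Fin n, MeasurableSet (cell p.1 p.2) :=
    fun p => measurableSet_cell p.1 p.2
  rw [← setIntegral_congr_set (iUnion_cell_ae_eq_square hn),
    integral_iUnion_fintype hm hdisj (integrableOn_cell hn hint)]

theorem volume_cell_lt_top {n : ℕ} (hn : 0 < n) (i j : Fin n) : volume (cell i j) < ⊤ := by
  have hle := measure_mono (μ := volume)
    (Set.subset_iUnion (fun p : Fin n × Fin n => cell p.1 p.2) (i, j))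
  rw [measure_congr (iUnion_cell_ae_eq_square hn), volume_square] at hle
  exact hle.trans_lt (by simp)

theorem abs_setIntegral_cell_sub_le {n : ℕ} (hn : 0 < n) {h : Plane → ℝ}
    (hint : IntegrableOn h square) (p : Fin n × Fin n) {c ε : ℝ}
    (hε : ∀ y ∈ cell p.1 p.2, |h y - c| ≤ ε) :
    |(∫ y in cell p.1 p.2, h y) - 4 / (n : ℝ) ^ 2 * c| ≤ ε * (4 / (n : ℝ) ^ 2) := by
  have hfin := volume_cell_lt_top hn p.1 p.2
  have hconst : ∫ _ in cell p.1 p.2, c = 4 / (n : ℝ) ^ 2 * c := by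
    rw [setIntegral_const, volume_cell, smul_eq_mul]
  have h1 : ‖∫ y in cell p.1 p.2, (h y - c)‖ ≤ ε * volume.real (cell p.1 p.2) :=
    norm_setIntegral_le_of_norm_le_const hfin hε
  rwa [integral_sub (integrableOn_cell hn hint p) (integrableOn_const hfin.ne), hconst,
    volume_cell] at h1

/-- The quadrature rule with one node per cell. -/
theorem abs_setIntegral_square_sub_sum_le {n : ℕ} (hn : 0 < n) {h : Plane → ℝ}
    (hint : IntegrableOn h square) {H : Fin n → Fin n → ℝ} {ε : ℝ}
    (hε : ∀ i j, ∀ y ∈ cell i j, |h y - H i j| ≤ ε) :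
    |(∫ y in square, h y) - 4 / (n : ℝ) ^ 2 * ∑ i, ∑ j, H i j| ≤ 4 * ε := by
  have hn' : (n : ℝ) ≠ 0 := by exact_mod_cast hn.ne'
  rw [setIntegral_square_eq_sum hn hint, ← Fintype.sum_prod_type', Finset.mul_sum,
    ← Finset.sum_sub_distrib]
  refine (Finset.abs_sum_le_sum_abs _ _).trans ((Finset.sum_le_sum fun p _ =>
    abs_setIntegral_cell_sub_le hn hint p (hε p.1 p.2)).trans_eq ?_)
  rw [Finset.sum_const, Finset.card_univ, Fintype.card_prod, Fintype.card_fin, nsmul_eq_mul,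
    Nat.cast_mul]
  field_simp

theorem norm_sub_gridPoint_le {n : ℕ} (hn : 0 < n) {i j : Fin n} {y : Plane} (hy : y ∈ cell i j) :
    ‖y - gridPoint i j‖ ≤ Real.sqrt 2 * (n : ℝ)⁻¹ := by
  have hn' : (0 : ℝ) < n := by exact_mod_cast hn
  have hcoord : ∀ (s t : ℝ), t ∈ Set.Ico (2 * s / n - 1) (2 * (s + 1) / n - 1) →
      (t - ((2 * s + 1) / n - 1)) ^ 2 ≤ ((n : ℝ)⁻¹) ^ 2 := fun s t ht => by
    have e1 : 2 * s / n = (2 * s + 1) / n - (n : ℝ)⁻¹ := by field_simp; ring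
    have e2 : 2 * (s + 1) / n = (2 * s + 1) / n + (n : ℝ)⁻¹ := by field_simp; ring
    rw [e1, e2] at ht
    rw [sq_le_sq, abs_of_pos (inv_pos.2 hn'), abs_le]
    exact ⟨by linarith [ht.1], by linarith [ht.2]⟩
  have h0 := hcoord _ _ hy.1
  have h1 := hcoord _ _ hy.2
  rw [EuclideanSpace.norm_eq, Real.sqrt_le_left (by positivity), mul_pow,
    Real.sq_sqrt zero_le_two, Fin.sum_univ_two]
  simp only [PiLp.sub_apply, gridPoint, Real.norm_eq_abs, sq_abs]
  simp only [Matrix.cons_val_zero, Matrix.cons_val_one]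
  linarith

theorem sample_offset {n : ℕ} (k : Plane → ℝ) (m l i j : Fin n) :
    sample n k (offset m i) (offset l j) = k (gridPoint m l - gridPoint i j) := by
  have hoff : ∀ m i : Fin n, (((offset m i : Fin (2 * n)) : ℕ) : ℝ) = m + n - i := fun m i => by
    rw [offset, Nat.cast_sub (by omega), Nat.cast_add]
  rw [sample, Matrix.of_apply, hoff, hoff]
  congr 1
  ext c
  fin_cases c <;> simp [gridPoint] <;> ring

theorem discConv_sample_apply {n : ℕ} (k : Plane → ℝ) (A : Matrix (Fin n) (Fin n) ℝ)
    (m l : Fin n) : discConv (sample n k) A m l =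
      4 / (n : ℝ) ^ 2 * ∑ i, ∑ j, k (gridPoint m l - gridPoint i j) * A i j := by
  simp only [discConv, Matrix.of_apply, sample_offset]

/-- The error of one discrete convolution. The function `α A + N` is known only through its values
`α A + N'` at the nodes, with an error at most `E`. -/
theorem abs_integral_sub_discConv_le {n : ℕ} (hn : 0 < n) (k : Plane →ᵇ ℝ) {L K : ℝ}
    (hL : ∀ x y, |k x - k y| ≤ L * ‖x - y‖) (hL0 : 0 ≤ L) (hK : ∀ x, |k x| ≤ K)
    {A N' : Matrix (Fin n) (Fin n) ℝ} {M : ℝ} (hA : ∀ i j, |A i j| ≤ M) (hM : 0 ≤ M)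
    {N : Plane → ℝ} (hN : Continuous N) {B D E α : ℝ} (hα : 0 ≤ α) (hB : ∀ y, |N y| ≤ B)
    (hD0 : 0 ≤ D) (hD : ∀ x y, |N x - N y| ≤ D * ‖x - y‖)
    (hE : ∀ i j, |N (gridPoint i j) - N' i j| ≤ E) (m l : Fin n) :
    |(∫ y in square, k (gridPoint m l - y) * (α * pieceConst A y + N y)) -
        discConv (sample n k) (α • A + N') m l| ≤
      4 * (L * (Real.sqrt 2 * (n : ℝ)⁻¹) * (α * M + B) +
        K * (D * (Real.sqrt 2 * (n : ℝ)⁻¹) + E)) := by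
  have hFB : ∀ y, |α * pieceConst A y + N y| ≤ α * M + B := fun y => by
    refine (abs_add_le _ _).trans (add_le_add ?_ (hB y))
    rw [abs_mul, abs_of_nonneg hα]
    gcongr
    exact abs_pieceConst_le hn hM hA y
  rw [discConv_sample_apply]
  refine abs_setIntegral_square_sub_sum_le hn ?_ fun i j y hy => ?_
  · refine Integrable.bdd_mul (c := ‖k‖) (Integrable.of_bound (C := α * M + B)
      (((measurable_pieceConst A).const_mul α).add hN.measurable).aestronglyMeasurable
      (.of_forall hFB))
      (by fun_prop : Continuous fun y => k (gridPoint m l - y)).aestronglyMeasurable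
      (.of_forall fun y => k.norm_coe_le_norm _)
  have hd := norm_sub_gridPoint_le hn hy
  have hAy := pieceConst_of_mem hn A hy
  have hk : |k (gridPoint m l - y) - k (gridPoint m l - gridPoint i j)| ≤
      L * (Real.sqrt 2 * (n : ℝ)⁻¹) := by
    refine (hL _ _).trans ?_
    rw [sub_sub_sub_cancel_left, norm_sub_rev]
    gcongr
  have hF : |N y - N' i j| ≤ D * (Real.sqrt 2 * (n : ℝ)⁻¹) + E := by
    refine (abs_sub_le _ (N (gridPoint i j)) _).trans (add_le_add ((hD _ _).trans ?_) (hE i j))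
    gcongr
  have hsplit : k (gridPoint m l - y) * (α * pieceConst A y + N y) -
      k (gridPoint m l - gridPoint i j) * (α • A + N') i j =
      (k (gridPoint m l - y) - k (gridPoint m l - gridPoint i j)) *
        (α * pieceConst A y + N y) + k (gridPoint m l - gridPoint i j) * (N y - N' i j) := by
    simp only [Matrix.add_apply, Matrix.smul_apply, smul_eq_mul, hAy]
    ring
  rw [hsplit]
  refine (abs_add_le _ _).trans (add_le_add ?_ ?_)
  · rw [abs_mul]
    exact mul_le_mul hk (hFB y) (abs_nonneg _) (by positivity)
  · rw [abs_mul]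
    exact mul_le_mul (hK _) hF (abs_nonneg _) ((abs_nonneg _).trans (hK 0))

/-! ### The two stages of the network -/

/-- The two blocks of a stacked array. -/
noncomputable def block {n : ℕ} (O : Stacked n) : Fin 2 → Matrix (Fin n) (Fin n) ℝ :=
  ![Pu n * O, Pl n * O]

theorem Pu_mul_apply {n : ℕ} (O : Stacked n) (i j : Fin n) : (Pu n * O) i j = O (.inl i) j := by
  simp [Pu, Matrix.mul_apply, Matrix.one_apply]

theorem Pl_mul_apply {n : ℕ} (O : Stacked n) (i j : Fin n) : (Pl n * O) i j = O (.inr i) j := by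
  simp [Pl, Matrix.mul_apply, Matrix.one_apply]

theorem Pu_transpose_mul {n : ℕ} (A : Matrix (Fin n) (Fin n) ℝ) :
    (Pu n)ᵀ * A = Matrix.fromRows A 0 := by
  rw [Pu, Matrix.transpose_fromCols, Matrix.fromRows_mul]
  simp

theorem Pl_transpose_mul {n : ℕ} (A : Matrix (Fin n) (Fin n) ℝ) :
    (Pl n)ᵀ * A = Matrix.fromRows 0 A := by
  rw [Pl, Matrix.transpose_fromCols, Matrix.fromRows_mul]
  simp

theorem abs_le_maxEntry {n : ℕ} (O : Stacked n) (p : Fin n ⊕ Fin n) (l : Fin n) :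
    |O p l| ≤ maxEntry O :=
  le_ciSup (f := fun p : (Fin n ⊕ Fin n) × Fin n => |O p.1 p.2|) (Set.finite_range _).bddAbove
    (p, l)

theorem maxEntry_nonneg {n : ℕ} (O : Stacked n) : 0 ≤ maxEntry O :=
  Real.iSup_nonneg fun _ => abs_nonneg _

theorem abs_block_le {n : ℕ} (O : Stacked n) (a : Fin 2) (i j : Fin n) :
    |block O a i j| ≤ maxEntry O := by
  fin_cases a
  · exact (congrArg _ (Pu_mul_apply O i j)).trans_le (abs_le_maxEntry O _ _)
  · exact (congrArg _ (Pl_mul_apply O i j)).trans_le (abs_le_maxEntry O _ _)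

theorem inputFun_eq {n : ℕ} (O : Stacked n) (a : Fin 2) :
    inputFun O a = pieceConst (block O a) := by
  fin_cases a <;> rfl

/-- The part of `g₁ * O` without the Dirac distributions. -/
noncomputable def smoothPart (ω : Fin 2 → ℝ) (α : ℝ) {n : ℕ} (O : Stacked n) (a : Fin 2)
    (x : Plane) : ℝ :=
  ∑ b, ∫ y in square, (g₁Kernel ω α a b).density (x - y) * pieceConst (block O b) y

/-- The discretization of `smoothPart` by the first stage of the network. -/
noncomputable def discSmoothPart (ω : Fin 2 → ℝ) (α : ℝ) {n : ℕ} (O : Stacked n) (a : Fin 2) :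
    Matrix (Fin n) (Fin n) ℝ :=
  ∑ b, discConv (sample n (g₁Kernel ω α a b).density) (block O b)

theorem matConv_eq (ω : Fin 2 → ℝ) (α : ℝ) {n : ℕ} (O : Stacked n) (a : Fin 2) (x : Plane) :
    matConv (g₁Kernel ω α) (inputFun O) a x =
      α * pieceConst (block O a) x + smoothPart ω α O a x := by
  simp only [matConv, Kernel.convOn, Finset.sum_add_distrib, inputFun_eq, smul_eq_mul]
  congr 1
  fin_cases a <;> simp [g₁Kernel, gKernel, Kernel.neg]

theorem discConv_sample_neg {n : ℕ} (k : Plane → ℝ) (A : Matrix (Fin n) (Fin n) ℝ) :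
    discConv (sample n fun x => -k x) A = -discConv (sample n k) A := by
  ext m l
  simp [discConv_sample_apply]

theorem discConv_sample_add {n : ℕ} (k k' : Plane → ℝ) (A : Matrix (Fin n) (Fin n) ℝ) :
    discConv (sample n fun x => k x + k' x) A =
      discConv (sample n k) A + discConv (sample n k') A := by
  ext m l
  simp [discConv_sample_apply, add_mul, Finset.sum_add_distrib, mul_add]

theorem gFilter_comm (ω : ℝ) (j j' : Fin 2) : gFilter ω j j' = gFilter ω j' j := by
  ext y
  change filterFun ω j j' y = filterFun ω j' j y
  simp only [filterFun, filterIntegrand, add_comm (j : ℕ), Nat.sub_right_comm 2 (j : ℕ)]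

theorem block_psi₁ (ω : Fin 2 → ℝ) (α : ℝ) {n : ℕ} (O : Stacked n) (a : Fin 2) :
    block (psi₁ α (fun j j' i => sample n (gFilter (ω i) j j')) O) a =
      α • block O a + discSmoothPart ω α O a := by
  have hd : ∀ (j j' : Fin 2) (A : Matrix (Fin n) (Fin n) ℝ),
      discConv (sample n (gKernel ω α j j').density) A =
      discConv (sample n (gFilter (ω 0) j j')) A + discConv (sample n (gFilter (ω 1) j j')) A :=
    fun j j' A => by
      rw [← discConv_sample_add]
      congr 2
      ext x
      simp [gKernel]
  have hdn : ∀ (j j' : Fin 2) (A : Matrix (Fin n) (Fin n) ℝ),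
      discConv (sample n (gKernel ω α j j').neg.density) A =
      -(discConv (sample n (gFilter (ω 0) j j')) A +
        discConv (sample n (gFilter (ω 1) j j')) A) :=
    fun j j' A => by
      rw [← hd, ← discConv_sample_neg]
      rfl
  ext m l
  fin_cases a
  · simp [block, Pu_mul_apply, psi₁, Pu_transpose_mul, Pl_transpose_mul, discSmoothPart, g₁Kernel,
      hd, hdn]
    ring
  · simp [block, Pl_mul_apply, psi₁, Pu_transpose_mul, Pl_transpose_mul, discSmoothPart, g₁Kernel,
      hd, hdn, gFilter_comm _ 1 0]
    ring

theorem exactInverse_apply (ω : Fin 2 → ℝ) (α β : ℝ) (k : Plane →ᵇ ℝ) {n : ℕ} (O : Stacked n)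
    (a : Fin 2) (m l : Fin n) :
    block (exactInverse ω α ⟨β, -k⟩ O) a m l =
      β * (α * pieceConst (block O a) (gridPoint m l) + smoothPart ω α O a (gridPoint m l)) -
      ∫ y in square, k (gridPoint m l - y) *
        (α * pieceConst (block O a) y + smoothPart ω α O a y) := by
  have h : block (exactInverse ω α ⟨β, -k⟩ O) a m l =
      (Kernel.mk β (-k)).convOn square (matConv (g₁Kernel ω α) (inputFun O) a)
        (gridPoint m l) := by
    fin_cases a
    · simp [block, Pu_mul_apply, exactInverse, discretize]
    · simp [block, Pl_mul_apply, exactInverse, discretize]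
  rw [h, Kernel.convOn, matConv_eq, sub_eq_add_neg, ← integral_neg]
  simp only [matConv_eq, smul_eq_mul, BoundedContinuousFunction.coe_neg, Pi.neg_apply, neg_mul]

theorem psi₂_apply (α : ℝ) {n : ℕ} (G₂ : ConvFilter n) (O : Stacked n) (a : Fin 2) (m l : Fin n) :
    block (psi₂ α G₂ O) a m l =
      (α ^ 2)⁻¹ * block O a m l - discConv G₂ (block O a) m l := by
  fin_cases a
  · simp [block, Pu_mul_apply, psi₂, Pu_transpose_mul, Pl_transpose_mul]
  · simp [block, Pl_mul_apply, psi₂, Pu_transpose_mul, Pl_transpose_mul]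

theorem maxEntry_le_of_block {n : ℕ} {O : Stacked n} {c : ℝ} (hc : 0 ≤ c)
    (h : ∀ a m l, |block O a m l| ≤ c) : maxEntry O ≤ c := by
  refine Real.iSup_le (fun p => ?_) hc
  obtain ⟨p | p, l⟩ := p
  · exact (congrArg _ (Pu_mul_apply O p l)).symm.trans_le (h 0 p l)
  · exact (congrArg _ (Pl_mul_apply O p l)).symm.trans_le (h 1 p l)

theorem abs_gFilter_le (ω : ℝ) (j j' : Fin 2) (x : Plane) :
    |gFilter ω j j' x| ≤ 4 * Real.pi ^ 2 * ‖farFieldConst ω‖ ^ 2 :=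
  (norm_filterFun_le ω j j' x).trans_eq (by ring)

theorem abs_gFilter_sub_le {ω : ℝ} (hω : 0 < ω) (j j' : Fin 2) (x y : Plane) :
    |gFilter ω j j' x - gFilter ω j j' y| ≤
      8 * Real.pi ^ 2 * ω * ‖farFieldConst ω‖ ^ 2 * ‖x - y‖ := by
  rw [gFilter_eq_cosTransform hω, gFilter_eq_cosTransform hω]
  refine (abs_cosTransform_sub_le (integrable_filterSpectrum hω j j')
    (filterSpectrum_eq_zero hω j j') x y).trans ?_
  have hπ := Real.pi_pos
  calc 2 * Real.pi * (ω / Real.pi) * (∫ ξ, |filterSpectrum ω j j' ξ|) * ‖x - y‖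
      ≤ 2 * Real.pi * (ω / Real.pi) * (‖farFieldConst ω‖ ^ 2 * (4 * Real.pi ^ 2)) * ‖x - y‖ := by
        gcongr
        exact integral_abs_filterSpectrum_le hω j j'
    _ = _ := by field_simp; ring

theorem abs_g₁Kernel_density_le (ω : Fin 2 → ℝ) (α : ℝ) (a b : Fin 2) (x : Plane) :
    |(g₁Kernel ω α a b).density x| ≤
      4 * Real.pi ^ 2 * (‖farFieldConst (ω 0)‖ ^ 2 + ‖farFieldConst (ω 1)‖ ^ 2) := by
  have h : ∀ j j', |(gKernel ω α j j').density x| ≤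
      4 * Real.pi ^ 2 * (‖farFieldConst (ω 0)‖ ^ 2 + ‖farFieldConst (ω 1)‖ ^ 2) := fun j j' => by
    rw [mul_add]
    simp only [gKernel, Fin.sum_univ_two, BoundedContinuousFunction.coe_add, Pi.add_apply]
    exact (abs_add_le _ _).trans (add_le_add (abs_gFilter_le _ j j' x) (abs_gFilter_le _ j j' x))
  fin_cases a <;> fin_cases b
  · exact h 1 1
  · exact (abs_neg _).trans_le (h 0 1)
  · exact (abs_neg _).trans_le (h 1 0)
  · exact h 0 0

theorem abs_g₁Kernel_density_sub_le {ω : Fin 2 → ℝ} (hω₁ : 0 < ω 0) (hω₂ : ω 0 < ω 1) (α : ℝ)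
    (a b : Fin 2) (x y : Plane) :
    |(g₁Kernel ω α a b).density x - (g₁Kernel ω α a b).density y| ≤
      8 * Real.pi ^ 2 * ω 1 * (‖farFieldConst (ω 0)‖ ^ 2 + ‖farFieldConst (ω 1)‖ ^ 2) *
        ‖x - y‖ := by
  have h : ∀ j j', |(gKernel ω α j j').density x - (gKernel ω α j j').density y| ≤
      8 * Real.pi ^ 2 * ω 1 * (‖farFieldConst (ω 0)‖ ^ 2 + ‖farFieldConst (ω 1)‖ ^ 2) *
        ‖x - y‖ := fun j j' => by
    simp only [gKernel, Fin.sum_univ_two, BoundedContinuousFunction.coe_add, Pi.add_apply]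
    rw [add_sub_add_comm, mul_add, add_mul]
    refine (abs_add_le _ _).trans (add_le_add ((abs_gFilter_sub_le hω₁ j j' x y).trans ?_)
      (abs_gFilter_sub_le (hω₁.trans hω₂) j j' x y))
    gcongr
  fin_cases a <;> fin_cases b
  · exact h 1 1
  · refine le_trans (le_of_eq ?_) (h 0 1)
    change |-_ - -_| = _
    rw [neg_sub_neg, abs_sub_comm]
  · refine le_trans (le_of_eq ?_) (h 1 0)
    change |-_ - -_| = _
    rw [neg_sub_neg, abs_sub_comm]
  · exact h 0 0

/-- The second stage uses the bounds on the spectrum of `g_{2,α}` twice: the bound by `α⁻²` where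
`g_{2,α}` acts on the smooth part of `g₁ * O`, the bound by `α⁻³` times the trace of the symbol of
`F*F` where it acts on the part `α O`. -/
theorem maxEntry_exactInverse_sub_le {ω : Fin 2 → ℝ} (hω₁ : 0 < ω 0) (hω₂ : ω 0 < ω 1) {α : ℝ}
    (hα : 0 < α) (hb : Integrable (invSpectrum ω α)) {n : ℕ} (hn : 0 < n) (O : Stacked n) :
    maxEntry (exactInverse ω α (Kernel.mk (α ^ 2)⁻¹ (-cosTransformBounded hb)) O -
        psi₂ α (sample n (cosTransformBounded hb))
          (psi₁ α (fun j j' i => sample n (gFilter (ω i) j j')) O)) ≤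
      (2 ^ 7 * Real.sqrt 2 * Real.pi * ω 1 *
          (‖farFieldConst (ω 0)‖ ^ 2 + ‖farFieldConst (ω 1)‖ ^ 2) *
          (Real.pi + 2 ^ 3 * ω 1 ^ 2)) * maxEntry O * (α ^ 2)⁻¹ * (n : ℝ)⁻¹ := by
  have hω : ∀ i, 0 < ω i := Fin.forall_fin_two.2 ⟨hω₁, hω₁.trans hω₂⟩
  have hπ := Real.pi_pos
  have hR : ∀ i, ω i / Real.pi ≤ ω 1 / Real.pi := Fin.forall_fin_two.2
    ⟨by gcongr, le_rfl⟩
  have hw := hω 1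
  set C := ‖farFieldConst (ω 0)‖ ^ 2 + ‖farFieldConst (ω 1)‖ ^ 2 with hC
  have hC0 : 0 ≤ C := by positivity
  set M := maxEntry O with hM
  have hM0 : 0 ≤ M := maxEntry_nonneg O
  set δ := Real.sqrt 2 * (n : ℝ)⁻¹ with hδ
  have hδ0 : 0 ≤ δ := by positivity
  set k := cosTransformBounded hb with hk
  set I := ∫ ξ, |invSpectrum ω α ξ| with hI
  have hI0 : 0 ≤ I := integral_nonneg fun _ => abs_nonneg _
  have hI1 : I ≤ (α ^ 2)⁻¹ * (ω 1 ^ 2 / Real.pi) :=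
    (integral_abs_invSpectrum_le hω (by positivity) hR hα).trans_eq (by field_simp)
  have hI2 : α * I ≤ (α ^ 2)⁻¹ * (8 * Real.pi ^ 2 * C) := by
    simpa [Fin.sum_univ_two] using integral_abs_invSpectrum_mul_le hω hR hα
  have hkI : ∀ x, |k x| ≤ I := abs_cosTransform_le hb
  have hkL : ∀ x y, |k x - k y| ≤ 2 * ω 1 * I * ‖x - y‖ := fun x y =>
    (abs_cosTransform_sub_le hb (invSpectrum_eq_zero hω hR α) x y).trans_eq
      (by rw [← hI]; field_simp)
  have hblock := abs_block_le O
  have hpc : ∀ b y, |pieceConst (block O b) y| ≤ M := fun b =>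
    abs_pieceConst_le hn hM0 (hblock b)
  have hpi : ∀ b, Integrable (pieceConst (block O b)) (volume.restrict square) := fun b =>
    Integrable.of_bound (measurable_pieceConst _).aestronglyMeasurable M (.of_forall (hpc b))
  have hdi : ∀ a b x, Integrable (fun y => (g₁Kernel ω α a b).density (x - y) *
      pieceConst (block O b) y) (volume.restrict square) := fun a b x =>
    integrable_density_smul _ (hpi b) x
  have hNc : ∀ a, Continuous (smoothPart ω α O a) := fun a =>
    continuous_finsetSum _ fun b _ => continuous_integral_density_smul _ (hpi b)
  have hNB : ∀ a x, |smoothPart ω α O a x| ≤ 32 * Real.pi ^ 2 * C * M := fun a x => by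
    have h : ∀ b, |∫ y in square, (g₁Kernel ω α a b).density (x - y) *
        pieceConst (block O b) y| ≤ 4 * (4 * Real.pi ^ 2 * C * M) := fun b =>
      abs_setIntegral_square_le fun y => by
        rw [abs_mul]
        exact mul_le_mul (abs_g₁Kernel_density_le ω α a b _) (hpc b y) (abs_nonneg _)
          (by positivity)
    rw [smoothPart, Fin.sum_univ_two]
    linarith [abs_add_le _ _ |>.trans (add_le_add (h 0) (h 1))]
  have hND : ∀ a x y, |smoothPart ω α O a x - smoothPart ω α O a y| ≤
      64 * Real.pi ^ 2 * ω 1 * C * M * ‖x - y‖ := fun a x y => by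
    have h : ∀ b, |(∫ z in square, (g₁Kernel ω α a b).density (x - z) *
        pieceConst (block O b) z) - ∫ z in square, (g₁Kernel ω α a b).density (y - z) *
        pieceConst (block O b) z| ≤ 4 * (8 * Real.pi ^ 2 * ω 1 * C * ‖x - y‖ * M) := fun b => by
      rw [← integral_sub (hdi a b x) (hdi a b y)]
      refine abs_setIntegral_square_le fun z => ?_
      rw [← sub_mul, abs_mul]
      refine mul_le_mul ?_ (hpc b z) (abs_nonneg _) (by positivity)
      simpa using abs_g₁Kernel_density_sub_le hω₁ hω₂ α a b (x - z) (y - z)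
    rw [smoothPart, smoothPart, Fin.sum_univ_two, Fin.sum_univ_two, add_sub_add_comm]
    linarith [abs_add_le _ _ |>.trans (add_le_add (h 0) (h 1))]
  -- the quadrature error of the first stage
  have hNE : ∀ a m l, |smoothPart ω α O a (gridPoint m l) - discSmoothPart ω α O a m l| ≤
      64 * Real.pi ^ 2 * ω 1 * C * M * δ := fun a m l => by
    have h : ∀ b, |(∫ y in square, (g₁Kernel ω α a b).density (gridPoint m l - y) *
        pieceConst (block O b) y) -
        discConv (sample n (g₁Kernel ω α a b).density) (block O b) m l| ≤
        4 * (8 * Real.pi ^ 2 * ω 1 * C * δ * M) := fun b => by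
      have h' := abs_integral_sub_discConv_le hn (g₁Kernel ω α a b).density
        (abs_g₁Kernel_density_sub_le hω₁ hω₂ α a b) (by positivity)
        (abs_g₁Kernel_density_le ω α a b) (hblock b) hM0 (N := 0) (N' := 0) (B := 0) (D := 0)
        (E := 0) continuous_zero zero_le_one (by simp) le_rfl (by simp) (by simp) m l
      simpa using h'
    rw [smoothPart, discSmoothPart, Fin.sum_univ_two, Fin.sum_univ_two, Matrix.add_apply,
      add_sub_add_comm]
    linarith [abs_add_le _ _ |>.trans (add_le_add (h 0) (h 1))]
  refine maxEntry_le_of_block (by positivity) fun a m l => ?_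
  have hsub : ∀ A B : Stacked n, block (A - B) a m l = block A a m l - block B a m l :=
    fun A B => by fin_cases a <;> simp [block, Matrix.mul_sub]
  have hgrid : gridPoint m l ∈ cell m l := by
    have hn' : (0 : ℝ) < n := by exact_mod_cast hn
    constructor <;> simp only [gridPoint, PiLp.toLp_apply, Matrix.cons_val_zero,
      Matrix.cons_val_one, Set.mem_Ico] <;> constructor <;> gcongr <;> linarith
  have h2 := abs_integral_sub_discConv_le hn k hkL (by positivity) hkI (hblock a) hM0 (hNc a)
    hα.le (hNB a) (by positivity) (hND a) (hNE a) m l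
  rw [← hδ] at h2
  rw [hsub, exactInverse_apply, psi₂_apply, block_psi₁, pieceConst_of_mem hn _ hgrid]
  set N := smoothPart ω α O a (gridPoint m l)
  set N' := discSmoothPart ω α O a m l with hN'
  have hrw : (α • block O a + discSmoothPart ω α O a) m l = α * block O a m l + N' := rfl
  rw [hrw]
  set P := ∫ y in square, k (gridPoint m l - y) *
    (α * pieceConst (block O a) y + smoothPart ω α O a y)
  set Q := discConv (sample n k) (α • block O a + discSmoothPart ω α O a) m l
  have h1 : (α ^ 2)⁻¹ * |N - N'| ≤ (α ^ 2)⁻¹ * (64 * Real.pi ^ 2 * ω 1 * C * M * δ) := by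
    gcongr
    exact hNE a m l
  have htri : |(α ^ 2)⁻¹ * (α * block O a m l + N) - P -
      ((α ^ 2)⁻¹ * (α * block O a m l + N') - Q)| ≤ (α ^ 2)⁻¹ * |N - N'| + |P - Q| := by
    rw [← abs_of_pos (by positivity : 0 < (α ^ 2)⁻¹), ← abs_mul,
      abs_of_pos (by positivity : 0 < (α ^ 2)⁻¹)]
    refine le_trans (le_of_eq ?_) (abs_sub _ _)
    congr 1
    ring
  refine htri.trans ((add_le_add h1 h2).trans ?_)
  -- the remaining inequality is linear in `I` and `α I`
  calc (α ^ 2)⁻¹ * (64 * Real.pi ^ 2 * ω 1 * C * M * δ) +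
        4 * (2 * ω 1 * I * δ * (α * M + 32 * Real.pi ^ 2 * C * M) +
          I * (64 * Real.pi ^ 2 * ω 1 * C * M * δ + 64 * Real.pi ^ 2 * ω 1 * C * M * δ))
      = ω 1 * M * δ * (64 * Real.pi ^ 2 * C * (α ^ 2)⁻¹ + 8 * (α * I) +
          768 * Real.pi ^ 2 * C * I) := by ring
    _ ≤ ω 1 * M * δ * (64 * Real.pi ^ 2 * C * (α ^ 2)⁻¹ +
          8 * ((α ^ 2)⁻¹ * (8 * Real.pi ^ 2 * C)) +
          768 * Real.pi ^ 2 * C * ((α ^ 2)⁻¹ * (ω 1 ^ 2 / Real.pi))) := by gcongr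
    _ = ω 1 * M * δ * (α ^ 2)⁻¹ * C * Real.pi * (128 * Real.pi + 768 * ω 1 ^ 2) := by
        field_simp; ring
    _ ≤ ω 1 * M * δ * (α ^ 2)⁻¹ * C * Real.pi * (128 * Real.pi + 1024 * ω 1 ^ 2) := by
        gcongr; norm_num
    _ = _ := by rw [hδ]; ring

end ScatteringCNN

theorem mainTheorem6 (ω : Fin 2 → ℝ) (hω₁ : 0 < ω 0) (hω₂ : ω 0 < ω 1) (α : ℝ) (hα : 0 < α) :
    -- `F*F + αI` on `(L²)²` of the unit disc is the convolution with `𝐠`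
    (∀ u v : Fin 2 → Plane → ℂ,
      (∀ j, MemLp (u j) 2 (volume.restrict (Metric.ball (0 : Plane) 1))) →
      (∀ j, MemLp (v j) 2 (volume.restrict (Metric.ball (0 : Plane) 1))) →
      normalForm ω α u v =
        ∑ j, ∫ y in Metric.ball (0 : Plane) 1, conj (u j y) *
          ∑ j', (gKernel ω α j j').convOn (Metric.ball (0 : Plane) 1) (v j') y) ∧
    -- the Fourier transform `S` of `𝐠` is a function, with determinant at least `α²`
    ∃ S : Plane → Matrix (Fin 2) (Fin 2) ℝ, IsSymbol ω α S ∧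
      (∀ᵐ ξ, α ^ 2 ≤ (S ξ).det) ∧
      -- the Fourier transform of `g₁` is the adjugate of `S`, so `(1 / det S)` times it is `S⁻¹`
      (∀ a b, Represents (fun ξ => (S ξ).adjugate a b) (𝓕 (g₁Kernel ω α a b).toDistribution)) ∧
      -- the inverse Fourier transform `g₂` of `1 / det S` is `α⁻² δ - g₂α`
      ∃ g₂α : Plane →ᵇ ℝ,
        Represents (fun ξ => ((S ξ).det)⁻¹)
          (𝓕 (Kernel.mk (α ^ 2)⁻¹ (-g₂α)).toDistribution) ∧
        -- the network with the sampled filters approximates `(g₂ I₂) * g₁ * O`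
        ∀ n : ℕ, 1 ≤ n →
          ∃ (G : Fin 2 → Fin 2 → Fin 2 → ConvFilter n) (G₂ : ConvFilter n),
            (∀ j j' i, G j j' i = sample n (gFilter (ω i) j j')) ∧
            G₂ = sample n g₂α ∧
            ∀ O : Stacked n,
              maxEntry (exactInverse ω α (Kernel.mk (α ^ 2)⁻¹ (-g₂α)) O -
                  psi₂ α G₂ (psi₁ α G O)) ≤
                (2 ^ 7 * Real.sqrt 2 * Real.pi * ω 1 *
                    (‖farFieldConst (ω 0)‖ ^ 2 + ‖farFieldConst (ω 1)‖ ^ 2) *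
                    (Real.pi + 2 ^ 3 * ω 1 ^ 2)) *
                  maxEntry O * (α ^ 2)⁻¹ * (n : ℝ)⁻¹ := by
  have hω : ∀ i, 0 < ω i := Fin.forall_fin_two.2 ⟨hω₁, hω₁.trans hω₂⟩
  have hb : Integrable (invSpectrum ω α) :=
    integrable_invSpectrum hω (R := ω 1 / Real.pi)
      (Fin.forall_fin_two.2 ⟨by have := Real.pi_pos; gcongr, le_rfl⟩) hα
  exact ⟨fun u v hu hv => normalForm_eq hω α hu hv, symbol ω α, isSymbol_symbol hω α,
    .of_forall (sq_le_det_symbol ω hα), represents_adjugate hω α, cosTransformBounded hb,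
    represents_inv_det hb, fun n hn => ⟨_, _, fun _ _ _ => rfl, rfl,
      maxEntry_exactInverse_sub_le hω₁ hω₂ hα hb hn⟩⟩
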